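/- Let $H$ be a complex Hilbert space and let $(M,\mathbf T,\alpha)$ be a periodic $W^*$-dynamical system in standard form on $H$. That is, $M\subset B(H)$ is a von Neumann algebra with a cyclic and separating unit vector $\xi_0\in H$, $\mathbf T$ is the circle group, and $\alpha$ is a $w^*$-continuous action of $\mathbf T$ by $*$-automorphisms of $M$ such that $\langle\alpha_z(m)\xi_0,\xi_0\rangle=\langle m\xi_0,\xi_0\rangle$ for all $z\in\mathbf T$, $m\in M$. Let $U_z$ be the unitary operator on $H$ determined by $U_z(m\xi_0)=\alpha_z(m)\xi_0$ for $m\in M$. For $n\in\mathbb Z$ put $$M_n=\{m\in M:\alpha_z(m)=z^nm\ \text{for all } z\in\mathbf T\},\qquad H_n=\{\xi\in H:U_z\xi=z^n\xi\ \text{for all } z\in\mathbf T\}.$$ Let $H_+=\bigoplus_{n\ge 0}H_n$ be the closed linear span of the $H_n$ with $n\ge0$, let $p_+$ be the orthogonal projection of $H$ onto $H_+$, let $\bigvee_{n\ge0}M_n$ be the weak-operator-closed algebra generated by the $M_n$ with $n\ge0$, and let $$M_+=p_+\Big(\bigvee_{n\ge0}M_n\Big)\Big|_{H_+}\subset B(H_+).$$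 If $M$ is abelian, then $M_+$ is reflexive. That is, every $b\in B(H_+)$ that leaves invariant every closed subspace of $H_+$ invariant under all operators in $M_+$ belongs to $M_+$, and conversely, so $M_+=\operatorname{algLat}(M_+)$. -/

import Mathlib

open scoped InnerProductSpace

noncomputable section

/-- `Lat A`: the closed subspaces of `X` that are invariant under every operator in `A`. -/
def invariantLattice {X : Type*} [NormedAddCommGroup X] [InnerProductSpace ℂ X]
    (A : Set (X →L[ℂ] X)) : Set (Submodule ℂ X) :=
  {K | IsClosed (K : Set X) ∧ ∀ a ∈ A, ∀ x ∈ K, a x ∈ K}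

/-- `algLat A`: the bounded operators leaving invariant every element of `Lat A`. -/
def algLat {X : Type*} [NormedAddCommGroup X] [InnerProductSpace ℂ X]
    (A : Set (X →L[ℂ] X)) : Set (X →L[ℂ] X) :=
  {b | ∀ K ∈ invariantLattice A, ∀ x ∈ K, b x ∈ K}

/-- `A` is reflexive if `A = algLat A`. (As `algLat A` is always a unital subalgebra which is
closed in the weak operator topology, this forces `A` to be one as well.) -/
def IsReflexive {X : Type*} [NormedAddCommGroup X] [InnerProductSpace ℂ X]
    (A : Set (X →L[ℂ] X)) : Prop :=
  A = algLat A

/-- The algebra generated by `S` and closed in the weak operator topology: the smallest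
subalgebra of `B(H)` which contains `S` and is closed in that topology. -/
def wotClosedAlgebra {H : Type*} [NormedAddCommGroup H] [InnerProductSpace ℂ H]
    (S : Set (H →L[ℂ] H)) : Subalgebra ℂ (H →L[ℂ] H) :=
  sInf {A | S ⊆ A ∧ IsClosed {T : H →WOT[ℂ] H | T.toCLM ∈ A}}

/-- A periodic W*-dynamical system `(M, 𝕋, α)` in standard form: a von Neumann algebra `M` on `H`
with a cyclic and separating unit vector `ξ₀`, and a w*-continuous action `α` of the circle group
by *-automorphisms of `M` which leaves the vector state of `ξ₀` invariant. -/
structure StandardPeriodicSystem (H : Type*) [NormedAddCommGroup H] [InnerProductSpace ℂ H]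
    [CompleteSpace H] where
  /-- The von Neumann algebra. -/
  M : VonNeumannAlgebra H
  /-- The action of the circle group by *-automorphisms. -/
  α : Circle →* (M.toStarSubalgebra ≃⋆ₐ[ℂ] M.toStarSubalgebra)
  /-- Each orbit map `z ↦ α z m` is continuous for the w*-topology of `M`, that is, after pairing
  with each σ-weakly continuous functional `a ↦ ∑ₖ ⟪η k, a (ξ k)⟫` where
  `∑ₖ ‖ξ k‖² < ∞` and `∑ₖ ‖η k‖² < ∞`. -/
  weakStar_continuous : ∀ (m : M.toStarSubalgebra) (ξ η : ℕ → H),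
    Summable (fun k => ‖ξ k‖ ^ 2) → Summable (fun k => ‖η k‖ ^ 2) →
      Continuous fun z : Circle => ∑' k, ⟪η k, (α z m : H →L[ℂ] H) (ξ k)⟫_ℂ
  /-- The distinguished vector. -/
  ξ₀ : H
  norm_ξ₀ : ‖ξ₀‖ = 1
  cyclic : Dense {ξ : H | ∃ m : M.toStarSubalgebra, (m : H →L[ℂ] H) ξ₀ = ξ}
  separating : ∀ m : M.toStarSubalgebra, (m : H →L[ℂ] H) ξ₀ = 0 → m = 0
  invariant : ∀ (z : Circle) (m : M.toStarSubalgebra),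
    ⟪ξ₀, (α z m : H →L[ℂ] H) ξ₀⟫_ℂ = ⟪ξ₀, (m : H →L[ℂ] H) ξ₀⟫_ℂ

namespace StandardPeriodicSystem

variable {H : Type*} [NormedAddCommGroup H] [InnerProductSpace ℂ H] [CompleteSpace H]
  (D : StandardPeriodicSystem H)

/-- The linear map `m ↦ m ξ₀` from `M` to `H`. -/
def orbitMap : D.M.toStarSubalgebra →ₗ[ℂ] H where
  toFun m := (m : H →L[ℂ] H) D.ξ₀
  map_add' _ _ := rfl
  map_smul' _ _ := rfl

theorem denseRange_orbitMap : DenseRange D.orbitMap := D.cyclic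

theorem norm_sq_orbitMap (m : D.M.toStarSubalgebra) :
    ((‖D.orbitMap m‖ ^ 2 : ℝ) : ℂ) = ⟪D.ξ₀, ((star m * m : D.M.toStarSubalgebra) : H →L[ℂ] H) D.ξ₀⟫_ℂ := by
  have h : ((star m * m : D.M.toStarSubalgebra) : H →L[ℂ] H) D.ξ₀
      = ContinuousLinearMap.adjoint (m : H →L[ℂ] H) ((m : H →L[ℂ] H) D.ξ₀) := rfl
  rw [h, ContinuousLinearMap.adjoint_inner_right, inner_self_eq_norm_sq_to_K]
  simp [orbitMap]

theorem norm_orbitMap_action (z : Circle) (m : D.M.toStarSubalgebra) :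
    ‖D.orbitMap (D.α z m)‖ = ‖D.orbitMap m‖ := by
  have h : ((‖D.orbitMap (D.α z m)‖ ^ 2 : ℝ) : ℂ) = ((‖D.orbitMap m‖ ^ 2 : ℝ) : ℂ) := by
    rw [norm_sq_orbitMap, norm_sq_orbitMap, ← map_star, ← map_mul, D.invariant]
  exact (sq_eq_sq₀ (norm_nonneg _) (norm_nonneg _)).1 (Complex.ofReal_injective h)

/-- The unitary operator `U z` on `H` determined by `U z (m ξ₀) = α z (m) ξ₀`. -/
def U (z : Circle) : H ≃ₗᵢ[ℂ] H :=
  (D.α z).toAlgEquiv.toLinearEquiv.extendOfIsometry D.orbitMap D.orbitMap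
    D.denseRange_orbitMap D.denseRange_orbitMap (D.norm_orbitMap_action z)

theorem U_apply (z : Circle) (m : D.M.toStarSubalgebra) :
    D.U z ((m : H →L[ℂ] H) D.ξ₀) = (D.α z m : H →L[ℂ] H) D.ξ₀ :=
  LinearEquiv.extendOfIsometry_eq (f := (D.α z).toAlgEquiv.toLinearEquiv)
    (e₁ := D.orbitMap) (e₂ := D.orbitMap)
    D.denseRange_orbitMap D.denseRange_orbitMap (D.norm_orbitMap_action z) m

/-- The spectral subspace `M_n = {m ∈ M | α z m = z ^ n m for all z}`. -/
def spectralSubspace (n : ℤ) : Set (H →L[ℂ] H) :=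
  {a | ∃ m : D.M.toStarSubalgebra, (m : H →L[ℂ] H) = a ∧
    ∀ z : Circle, D.α z m = ((z ^ n : Circle) : ℂ) • m}

/-- The spectral subspace `H_n = {ξ ∈ H | U z ξ = z ^ n ξ for all z}`. -/
def hilbertSpectralSubspace (n : ℤ) : Submodule ℂ H where
  carrier := {ξ | ∀ z : Circle, D.U z ξ = ((z ^ n : Circle) : ℂ) • ξ}
  add_mem' {ξ η} hξ hη z := by rw [map_add, hξ z, hη z, smul_add]
  zero_mem' z := by rw [map_zero, smul_zero]
  smul_mem' c ξ hξ z := by rw [map_smul, hξ z, smul_comm]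

/-- The generalized Hardy space `H₊`: the closed linear span of the `H_n`, `n ≥ 0`. -/
def hardySpace : Submodule ℂ H :=
  (⨆ n : ℕ, D.hilbertSpectralSubspace n).topologicalClosure

instance : CompleteSpace D.hardySpace :=
  (Submodule.isClosed_topologicalClosure _).completeSpace_coe

/-- The compression `p₊ a|_{H₊}` to `H₊` of an operator `a` on `H`. -/
def compression (a : H →L[ℂ] H) : D.hardySpace →L[ℂ] D.hardySpace :=
  D.hardySpace.orthogonalProjectionOnto ∘L a ∘L D.hardySpace.subtypeL

/-- The algebra of analytic elements `M₊ = p₊ (⋁_{n ≥ 0} M_n)|_{H₊} ⊆ B(H₊)`, where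
`⋁_{n ≥ 0} M_n` is the algebra generated by the `M_n`, `n ≥ 0`, and closed in the weak operator
topology. -/
def analyticAlgebra : Set (D.hardySpace →L[ℂ] D.hardySpace) :=
  D.compression '' (wotClosedAlgebra (⋃ n : ℕ, D.spectralSubspace n) : Set (H →L[ℂ] H))

end StandardPeriodicSystem

end

/-! Let `b` lie in `algLat` of `M₊`. Since `M` is abelian, every operator in the analytic algebra
`⋁_{n ≥ 0} M_n` compresses to an operator whose closed range is invariant under `M₊`, hence under
`b`. The proof first turns this supply of invariant subspaces into commutation of `b` with `M₊`.

For a projection `e` in `M_0`, invariance of the ranges of `e` and `1 - e` makes `b` commute with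
the compression of `e`; `M_0` is the closed span of its projections, so `b` commutes with all of
`M_0` (`algLat_commute_compression_zero`). For a partial isometry `v` in `M_n`, `n > 0`, the
compression `S` is a pure partial isometry, and `b` preserves the closed range of every `S - z`.
Commutators `(bS - Sb)ξ` are therefore orthogonal to the eigenvectors `∑ z^j S^j x` of `S*`;
comparing coefficients in `z` and using a Wold argument, they lie in `⋂ ran S^j = 0`
(`mul_comm_of_closure_range_invariant`). Polar decomposition inside the spectral subspaces covers a
general element of `M_n`.

It remains to represent `b` by an element of `M`. Put `a (m ξ₀) = m (b ξ₀)` for trigonometric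
polynomials `m`. For analytic `m` the right side is `b (m ξ₀)`, and any `m` becomes analytic after
multiplication by an isometry of `M`, so `a` is bounded (`norm_apply_algLat_le`). Now `a` and the
commutant of `M` both commute with the trigonometric polynomials, an abelian family with cyclic
vector `ξ₀`, whose commutant is abelian; hence `a ∈ M'' = M`. As `a ξ₀ = b ξ₀` lies in `H₊`, the
negative Fourier coefficients of `a` vanish, and Fourier averaging puts `a` in the analytic algebra.
Its compression agrees with `b` on each `M_n ξ₀`, `n ≥ 0`, hence on `H₊`. -/

noncomputable section

/-! ### Range projections and polar decomposition -/

section Hilbert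

variable {H : Type*} [NormedAddCommGroup H] [InnerProductSpace ℂ H] [CompleteSpace H]

namespace ContinuousLinearMap

/-- The orthogonal projection onto the closure of the range of `h`. -/
def rangeProj (h : H →L[ℂ] H) : H →L[ℂ] H :=
  (LinearMap.range (h : H →ₗ[ℂ] H)).topologicalClosure.starProjection

theorem isStarProjection_rangeProj (h : H →L[ℂ] H) : IsStarProjection h.rangeProj :=
  isStarProjection_starProjection

theorem star_rangeProj (h : H →L[ℂ] H) : star h.rangeProj = h.rangeProj :=
  h.isStarProjection_rangeProj.isSelfAdjoint

theorem rangeProj_mul_rangeProj (h : H →L[ℂ] H) : h.rangeProj * h.rangeProj = h.rangeProj :=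
  h.isStarProjection_rangeProj.isIdempotentElem

omit [CompleteSpace H] in
theorem apply_mem_closure_range (h : H →L[ℂ] H) (x : H) :
    h x ∈ (LinearMap.range (h : H →ₗ[ℂ] H)).topologicalClosure :=
  Submodule.le_topologicalClosure _ ⟨x, rfl⟩

theorem rangeProj_mul (h : H →L[ℂ] H) : h.rangeProj * h = h := by
  ext x
  exact Submodule.starProjection_eq_self_iff.2 (h.apply_mem_closure_range x)

theorem mul_rangeProj_congr {h T S : H →L[ℂ] H} (hTS : T * h = S * h) :
    T * h.rangeProj = S * h.rangeProj := by
  have key : ∀ x ∈ (LinearMap.range (h : H →ₗ[ℂ] H)).topologicalClosure, T x = S x := by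
    intro x hx
    refine closure_minimal (t := {x | T x = S x}) ?_ (isClosed_eq T.continuous S.continuous) hx
    rintro _ ⟨y, rfl⟩
    exact congr($hTS y)
  ext x
  exact key _ (Submodule.starProjection_apply_mem _ x)

theorem mul_rangeProj_eq_zero {h T : H →L[ℂ] H} (hT : T * h = 0) : T * h.rangeProj = 0 := by
  simpa using mul_rangeProj_congr (h := h) (T := T) (S := 0) (by simpa using hT)

/-- Both `T` and its adjoint preserve the closed range of `h`, so that subspace reduces `T`. -/
theorem commute_rangeProj {h T : H →L[ℂ] H} (h₁ : Commute T h) (h₂ : Commute (star T) h) :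
    Commute T h.rangeProj := by
  have key : ∀ R : H →L[ℂ] H, Commute R h → R * h.rangeProj = h.rangeProj * R * h.rangeProj := by
    intro R hR
    refine mul_rangeProj_congr ?_
    rw [mul_assoc, hR.eq, ← mul_assoc, rangeProj_mul]
  have h3 := congr(star $(key _ h₂))
  simp only [star_mul, star_star, star_rangeProj] at h3
  rw [← mul_assoc] at h3
  exact (key _ h₁).trans h3.symm

/-- The positive part `|m|` of the polar decomposition of `m`. -/
def modulus (m : H →L[ℂ] H) : H →L[ℂ] H := CFC.sqrt (star m * m)

theorem isSelfAdjoint_modulus (m : H →L[ℂ] H) : IsSelfAdjoint m.modulus :=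
  (CFC.sqrt_nonneg _).isSelfAdjoint

theorem modulus_mul_modulus (m : H →L[ℂ] H) : m.modulus * m.modulus = star m * m :=
  CFC.sqrt_mul_sqrt_self _ (star_mul_self_nonneg m)

theorem commute_modulus {m T : H →L[ℂ] H} (hT : Commute T (star m * m)) : Commute T m.modulus :=
  (hT.symm.cfcₙ_nnreal _).symm

theorem inner_map_map (a : H →L[ℂ] H) (x y : H) : ⟪a x, a y⟫_ℂ = ⟪x, (star a * a) y⟫_ℂ := by
  rw [star_eq_adjoint]
  exact (adjoint_inner_right a x (a y)).symm

theorem norm_modulus_apply (m : H →L[ℂ] H) (x : H) : ‖m.modulus x‖ = ‖m x‖ := by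
  have h1 := inner_map_map m.modulus x x
  rw [m.isSelfAdjoint_modulus.star_eq, modulus_mul_modulus, ← inner_map_map] at h1
  rw [inner_self_eq_norm_sq_to_K, inner_self_eq_norm_sq_to_K] at h1
  have h2 : ‖m.modulus x‖ ^ 2 = ‖m x‖ ^ 2 := by exact_mod_cast h1
  exact (sq_eq_sq₀ (norm_nonneg _) (norm_nonneg _)).1 h2

/-- The map `|m| x ↦ m x` is isometric because `‖|m| x‖ = ‖m x‖`; it extends to the closed range of
`|m|` and is set to zero on the orthogonal complement. -/
theorem exists_polar_decomposition (m : H →L[ℂ] H) :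
    ∃ v : H →L[ℂ] H, v * m.modulus = m ∧ v * m.modulus.rangeProj = v ∧
      star v * v = m.modulus.rangeProj := by
  set h := m.modulus with hh
  set K := (LinearMap.range (h : H →ₗ[ℂ] H)).topologicalClosure with hK
  let e : H →ₗ[ℂ] K := (h : H →ₗ[ℂ] H).codRestrict K h.apply_mem_closure_range
  have hd : DenseRange e := by
    rw [DenseRange, Subtype.dense_iff]
    intro x hx
    have : ((↑) '' Set.range e : Set H) = LinearMap.range (h : H →ₗ[ℂ] H) := by
      ext y
      constructor
      · rintro ⟨_, ⟨z, rfl⟩, rfl⟩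
        exact ⟨z, rfl⟩
      · rintro ⟨z, rfl⟩
        exact ⟨_, ⟨z, rfl⟩, rfl⟩
    have hx' : (x : H) ∈ closure ((LinearMap.range (h : H →ₗ[ℂ] H) : Submodule ℂ H) : Set H) := hx
    rw [← this] at hx'
    exact hx'
  let v₀ : K →L[ℂ] H := (m : H →ₗ[ℂ] H).extendOfNorm e
  have hv₀ : ∀ x, v₀ (e x) = m x := fun x =>
    LinearMap.extendOfNorm_eq hd ⟨1, fun y => by
      rw [one_mul]; exact (norm_modulus_apply m y).ge⟩ x
  let v : H →L[ℂ] H := v₀ ∘L K.orthogonalProjectionOnto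
  have h1 : v * h = m := by
    ext x
    rw [← hv₀ x]
    exact congrArg v₀ (Submodule.orthogonalProjectionOnto_mem_subspace_eq_self (e x))
  have h2 : v * h.rangeProj = v := by
    ext x
    exact congrArg v₀
      (Submodule.orthogonalProjectionOnto_mem_subspace_eq_self (K.orthogonalProjectionOnto x))
  have h2' : h.rangeProj * star v = star v := by
    simpa [star_rangeProj] using congr(star $h2)
  refine ⟨v, h1, h2, ?_⟩
  have hsa : star h = h := m.isSelfAdjoint_modulus
  -- The identity `h v*v h = h h` is cancelled on both sides by `mul_rangeProj_congr`, the left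
  -- cancellation being done on adjoints.
  have h3 : h * (star v * v * h) = h * h := by
    have : h * star v = star m := by rw [← h1, star_mul, hsa]
    rw [mul_assoc, h1, ← mul_assoc, this, hh, modulus_mul_modulus]
  have h4 : star (star v * v * h) * h = h * h := by
    simpa only [star_mul, star_star, hsa, mul_assoc] using congr(star $h3)
  have h5 := congr(star $(mul_rangeProj_congr h4))
  simp only [star_mul, star_star, star_rangeProj, hsa] at h5
  rw [rangeProj_mul, ← mul_assoc, ← mul_assoc, h2'] at h5
  have h6 := mul_rangeProj_congr (h := h) (T := star v * v) (S := 1) (by rw [h5, one_mul])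
  rwa [mul_assoc, h2, one_mul] at h6

/-- With `T = U z` and `c = z ^ n` this says that the polar part has the same degree as `m`; with `c
= 1` it keeps the polar part in the von Neumann algebra. -/
theorem polar_semicommute {m v T : H →L[ℂ] H} {c : ℂ} (h₁ : v * m.modulus = m)
    (h₂ : v * m.modulus.rangeProj = v) (hT : T * m = c • (m * T))
    (hc : Commute T m.modulus) (hc' : Commute (star T) m.modulus) : T * v = c • (v * T) := by
  have h3 : T * v * m.modulus = (c • (v * T)) * m.modulus := by
    rw [mul_assoc, h₁, hT, smul_mul_assoc, mul_assoc, hc.eq, ← mul_assoc, h₁]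
  have h4 := mul_rangeProj_congr h3
  rwa [mul_assoc, h₂, smul_mul_assoc, mul_assoc, (commute_rangeProj hc hc').eq, ← mul_assoc,
    h₂] at h4

/-! ### Norm approximation by projections -/

/-- The factors `c - a` and `c + a` are positive and commute, so their product `c² - a²` is
positive. -/
theorem norm_le_of_neg_le_of_le {a : H →L[ℂ] H} {c : ℝ} (hc : 0 ≤ c) (ha : IsSelfAdjoint a)
    (h₁ : 0 ≤ algebraMap ℝ _ c - a) (h₂ : 0 ≤ algebraMap ℝ _ c + a) : ‖a‖ ≤ c := by
  have hcomm : Commute (algebraMap ℝ (H →L[ℂ] H) c) a := Algebra.commutes c a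
  have h3 : 0 ≤ (algebraMap ℝ (H →L[ℂ] H) c - a) * (algebraMap ℝ _ c + a) :=
    Commute.mul_nonneg h₁ h₂
      (((Commute.refl _).add_right hcomm).sub_left (hcomm.symm.add_right (Commute.refl _)))
  have h4 : star a * a ≤ algebraMap ℝ _ (c ^ 2) := by
    rw [← sub_nonneg]
    convert h3 using 1
    rw [ha.star_eq, sub_mul, mul_add, mul_add, hcomm.eq, ← map_mul, ← sq c]
    abel
  have h5 := (CStarAlgebra.norm_le_iff_le_algebraMap _ (sq_nonneg c) (star_mul_self_nonneg a)).2 h4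
  rw [CStarRing.norm_star_mul_self, ← sq] at h5
  exact (sq_le_sq₀ (norm_nonneg _) hc).1 h5

theorem le_smul_rangeProj {g : H →L[ℂ] H} (hg : 0 ≤ g) {r : ℝ} (hr : ‖g‖ ≤ r) :
    g ≤ r • g.rangeProj := by
  have hr0 : 0 ≤ r := (norm_nonneg _).trans hr
  have h1 := (CStarAlgebra.norm_le_iff_le_algebraMap g hr0 hg).1 hr
  have h2 := star_left_conjugate_le_conjugate h1 g.rangeProj
  have h3 : g * g.rangeProj = g := by
    simpa [star_rangeProj, hg.isSelfAdjoint.star_eq] using congr(star $(g.rangeProj_mul))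
  rwa [star_rangeProj, mul_assoc, h3, rangeProj_mul, Algebra.algebraMap_eq_smul_one,
    mul_smul_comm, mul_one, smul_mul_assoc, rangeProj_mul_rangeProj] at h2

/-- Where `h` is positive its values lie in `[0, ‖h‖]`, and subtracting the midpoint leaves at most
`‖h‖ / 2` in absolute value; the negative part is symmetric. -/
theorem norm_sub_projections_le {h : H →L[ℂ] H} (hh : IsSelfAdjoint h) :
    ‖h - (‖h‖ / 2) • (h⁺.rangeProj - h⁻.rangeProj)‖ ≤ ‖h‖ / 2 := by
  set g := h⁺
  set g' := h⁻
  set e := g.rangeProj with he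
  set e' := g'.rangeProj with he'
  set c := ‖h‖ / 2 with hc
  have hc0 : 0 ≤ c := by positivity
  have hg : 0 ≤ g := CFC.posPart_nonneg h
  have hg' : 0 ≤ g' := CFC.negPart_nonneg h
  have hsub : g - g' = h := CFC.posPart_sub_negPart h hh
  have h1 : g ≤ ‖h‖ • e := le_smul_rangeProj hg (CStarAlgebra.norm_posPart_le h)
  have h2 : g' ≤ ‖h‖ • e' := le_smul_rangeProj hg' (CStarAlgebra.norm_negPart_le h)
  have hnorm : ‖h‖ = c + c := by rw [hc]; ring
  have h3 : e * e' = 0 := by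
    have h4 : g' * e = 0 := mul_rangeProj_eq_zero (CFC.negPart_mul_posPart h)
    have h5 : e * g' = 0 := by
      simpa [he, star_rangeProj, hg'.isSelfAdjoint.star_eq] using congr(star $h4)
    exact mul_rangeProj_eq_zero h5
  have h3' : e' * e = 0 := by simpa [he, he', star_rangeProj] using congr(star $h3)
  have hee : e * e = e := g.rangeProj_mul_rangeProj
  have hee' : e' * e' = e' := g'.rangeProj_mul_rangeProj
  have h6 : 0 ≤ 1 - e - e' := by
    have : star (1 - e - e') * (1 - e - e') = 1 - e - e' := by
      simp only [star_sub, star_one, he, he', star_rangeProj]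
      rw [← he, ← he']
      simp only [mul_sub, sub_mul, mul_one, one_mul, h3, h3', hee, hee']
      abel
    rw [← this]
    exact star_mul_self_nonneg _
  have h7 := smul_nonneg hc0 h6
  refine norm_le_of_neg_le_of_le hc0 ?_ ?_ ?_
  · refine hh.sub (IsSelfAdjoint.smul (by simp [IsSelfAdjoint]) ?_)
    exact g.isStarProjection_rangeProj.isSelfAdjoint.sub g'.isStarProjection_rangeProj.isSelfAdjoint
  · have h8 := add_nonneg (add_nonneg h7 (sub_nonneg.2 h1)) hg'
    convert h8 using 1
    rw [Algebra.algebraMap_eq_smul_one, hnorm]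
    nth_rw 1 [← hsub]
    module
  · have h8 := add_nonneg (add_nonneg h7 (sub_nonneg.2 h2)) hg
    convert h8 using 1
    rw [Algebra.algebraMap_eq_smul_one, hnorm]
    nth_rw 1 [← hsub]
    module

theorem commute_posPart {h T : H →L[ℂ] H} (hT : Commute T h) : Commute T h⁺ :=
  (hT.symm.cfcₙ_real _).symm

theorem commute_negPart {h T : H →L[ℂ] H} (hT : Commute T h) : Commute T h⁻ :=
  (hT.symm.cfcₙ_real _).symm

theorem rangeProj_mem_centralizer {S : Set (H →L[ℂ] H)} (hS : ∀ T ∈ S, star T ∈ S)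
    {h : H →L[ℂ] H} (hh : h ∈ S.centralizer) : h.rangeProj ∈ S.centralizer :=
  fun T hT => commute_rangeProj (hh T hT) (hh _ (hS T hT))

/-- Each subtraction of a multiple of a difference of two projections halves the norm and stays in
the commutant, so iteration approximates `h` geometrically without the spectral theorem. -/
theorem isSelfAdjoint_mem_of_projections_mem {S : Set (H →L[ℂ] H)} (hS : ∀ T ∈ S, star T ∈ S)
    (W : Submodule ℂ (H →L[ℂ] H)) (hW : IsClosed (W : Set (H →L[ℂ] H)))
    (hproj : ∀ e ∈ S.centralizer, IsStarProjection e → e ∈ W)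
    {h : H →L[ℂ] H} (hh : h ∈ S.centralizer) (hsa : IsSelfAdjoint h) : h ∈ W := by
  have approx : ∀ n : ℕ, ∀ h ∈ S.centralizer, IsSelfAdjoint h →
      ∃ q ∈ W, ‖h - q‖ ≤ (1 / 2) ^ n * ‖h‖ := by
    intro n
    induction n with
    | zero => exact fun h _ _ => ⟨0, W.zero_mem, by simp⟩
    | succ n ih =>
      intro h hh hsa
      have hp : h⁺.rangeProj ∈ S.centralizer :=
        rangeProj_mem_centralizer hS fun T hT => commute_posPart (hh T hT)
      have hn : h⁻.rangeProj ∈ S.centralizer :=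
        rangeProj_mem_centralizer hS fun T hT => commute_negPart (hh T hT)
      set q := (‖h‖ / 2) • (h⁺.rangeProj - h⁻.rangeProj) with hq
      have hqS : q ∈ Subalgebra.centralizer ℝ S :=
        Subalgebra.smul_mem _ (Subalgebra.sub_mem _ hp hn) _
      have hqW : q ∈ W := W.smul_of_tower_mem _
        (W.sub_mem (hproj _ hp (isStarProjection_rangeProj _))
          (hproj _ hn (isStarProjection_rangeProj _)))
      have hqsa : IsSelfAdjoint q := IsSelfAdjoint.smul (by simp [IsSelfAdjoint])
        ((isStarProjection_rangeProj _).isSelfAdjoint.sub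
          (isStarProjection_rangeProj _).isSelfAdjoint)
      obtain ⟨q', hq'W, hq'⟩ := ih (h - q)
        (Subalgebra.sub_mem (Subalgebra.centralizer ℝ S) hh hqS) (hsa.sub hqsa)
      refine ⟨q + q', W.add_mem hqW hq'W, ?_⟩
      rw [← sub_sub]
      refine hq'.trans ?_
      rw [pow_succ, mul_assoc]
      gcongr
      have := norm_sub_projections_le hsa
      linarith
  refine hW.closure_subset (Metric.mem_closure_iff.2 fun ε hε => ?_)
  have hlim : Filter.Tendsto (fun n : ℕ => (1 / 2 : ℝ) ^ n * ‖h‖) Filter.atTop (nhds 0) := by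
    simpa using (tendsto_pow_atTop_nhds_zero_of_lt_one (r := (1 / 2 : ℝ)) (by norm_num)
      (by norm_num)).mul_const ‖h‖
  obtain ⟨n, hn⟩ := (hlim.eventually (gt_mem_nhds hε)).exists
  obtain ⟨q, hqW, hq⟩ := approx n h hh hsa
  exact ⟨q, hqW, by rw [dist_eq_norm]; exact hq.trans_lt hn⟩

/-- A von Neumann algebra is the closed linear span of its projections. -/
theorem mem_of_projections_mem {S : Set (H →L[ℂ] H)} (hS : ∀ T ∈ S, star T ∈ S)
    (W : Submodule ℂ (H →L[ℂ] H)) (hW : IsClosed (W : Set (H →L[ℂ] H)))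
    (hproj : ∀ e ∈ S.centralizer, IsStarProjection e → e ∈ W)
    {h : H →L[ℂ] H} (hh : h ∈ S.centralizer) : h ∈ W := by
  have hstar : star h ∈ S.centralizer := by
    intro T hT
    simpa using congr(star $(hh _ (hS T hT))).symm
  let C := Subalgebra.centralizer ℂ S
  have h1 : h + star h ∈ W := isSelfAdjoint_mem_of_projections_mem hS W hW hproj
    (C.add_mem hh hstar) (.add_star_self h)
  have h2 : Complex.I • (h - star h) ∈ W := isSelfAdjoint_mem_of_projections_mem hS W hW hproj
    (C.smul_mem (C.sub_mem hh hstar) _) (by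
      simp only [IsSelfAdjoint, star_smul, star_sub, star_star, RCLike.star_def, Complex.conj_I]
      module)
  have h3 := W.smul_mem (1 / 2 : ℂ) (W.add_mem h1 (W.smul_mem (-Complex.I) h2))
  convert h3 using 1
  rw [smul_smul, neg_mul, Complex.I_mul_I]
  module

/-! ### Abelian families with a cyclic vector -/

/-- The commutant of a commutative self-adjoint set with a cyclic vector is commutative. -/
theorem commute_of_mem_centralizer {N : Submodule ℂ (H →L[ℂ] H)} (hstar : ∀ a ∈ N, star a ∈ N)
    (hcomm : ∀ a ∈ N, ∀ b ∈ N, a * b = b * a) {ξ : H}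
    (hξ : Dense ((fun a : H →L[ℂ] H => a ξ) '' N)) {S T : H →L[ℂ] H}
    (hS : S ∈ Set.centralizer (N : Set (H →L[ℂ] H)))
    (hT : T ∈ Set.centralizer (N : Set (H →L[ℂ] H))) : S * T = T * S := by
  have hS' : ∀ a ∈ N, ∀ x, a (S x) = S (a x) := fun a ha x => congr($(hS a ha) x)
  have hT' : ∀ a ∈ N, ∀ x, a (T x) = T (a x) := fun a ha x => congr($(hT a ha) x)
  have hN' : ∀ a ∈ N, ∀ b ∈ N, ∀ x, a (b x) = b (a x) :=
    fun a ha b hb x => congr($(hcomm a ha b hb) x)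
  have hadj : ∀ (a : H →L[ℂ] H) (x y : H), ⟪a x, y⟫_ℂ = ⟪x, star a y⟫_ℂ := fun a x y => by
    rw [star_eq_adjoint, adjoint_inner_right]
  -- Elements of `N` are normal, so if `n k ξ` converges then `star (n k) ξ` is Cauchy.
  have hnorm : ∀ a ∈ N, ‖star a ξ‖ = ‖a ξ‖ := by
    intro a ha
    have h1 : (⟪star a ξ, star a ξ⟫_ℂ) = ⟪a ξ, a ξ⟫_ℂ := by
      rw [hadj, star_star, hN' a ha _ (hstar a ha), ← hadj]
    rw [inner_self_eq_norm_sq_to_K, inner_self_eq_norm_sq_to_K] at h1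
    have h2 : ‖star a ξ‖ ^ 2 = ‖a ξ‖ ^ 2 := by exact_mod_cast h1
    exact (sq_eq_sq₀ (norm_nonneg _) (norm_nonneg _)).1 h2
  obtain ⟨y, hy, hlim⟩ := mem_closure_iff_seq_limit.1 (hξ (T ξ))
  choose n hn hny using hy
  have hlim1 : Filter.Tendsto (fun k => n k ξ) Filter.atTop (nhds (T ξ)) := by
    simpa only [hny] using hlim
  have hcauchy : CauchySeq fun k => star (n k) ξ := by
    have h1 := Metric.cauchySeq_iff.1 hlim1.cauchySeq
    refine Metric.cauchySeq_iff.2 fun ε hε => ?_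
    obtain ⟨k₀, hk₀⟩ := h1 ε hε
    refine ⟨k₀, fun k hk l hl => ?_⟩
    have h2 := hnorm _ (N.sub_mem (hn k) (hn l))
    rw [star_sub, sub_apply, sub_apply, ← dist_eq_norm, ← dist_eq_norm] at h2
    rw [h2]
    exact hk₀ k hk l hl
  obtain ⟨ζ, hζ⟩ := cauchySeq_tendsto_of_complete hcauchy
  have hζT : ζ = star T ξ := by
    refine hξ.eq_of_inner_left ℂ ?_
    rintro _ ⟨a, ha, rfl⟩
    have h1 : Filter.Tendsto (fun k => ⟪star (n k) ξ, a ξ⟫_ℂ) Filter.atTop (nhds ⟪ζ, a ξ⟫_ℂ) :=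
      hζ.inner tendsto_const_nhds
    have h2 : Filter.Tendsto (fun k => ⟪star (n k) ξ, a ξ⟫_ℂ) Filter.atTop
        (nhds ⟪star T ξ, a ξ⟫_ℂ) := by
      have : ∀ k, ⟪star (n k) ξ, a ξ⟫_ℂ = ⟪ξ, a (n k ξ)⟫_ℂ := fun k => by
        rw [hadj, star_star, hN' _ (hn k) a ha]
      simp only [this]
      rw [hadj, star_star, ← hT' a ha]
      exact tendsto_const_nhds.inner ((a.continuous.tendsto _).comp hlim1)
    exact tendsto_nhds_unique h1 h2
  subst hζT
  have hTs : ∀ a ∈ N, ∀ x, star T (a x) = a (star T x) := by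
    intro a ha x
    have h1 : star T * a = a * star T := by
      simpa only [star_mul, star_star] using congr(star $(hT _ (hstar a ha)))
    exact congr($h1 x)
  have hdense : ∀ x, (S * T) x = (T * S) x := by
    refine fun x => congrFun (Continuous.ext_on hξ (S * T).continuous (T * S).continuous ?_) x
    rintro _ ⟨a, ha, rfl⟩
    refine hξ.eq_of_inner_left ℂ ?_
    rintro _ ⟨c, hc, rfl⟩
    -- The same matrix coefficients are evaluated in the limit twice: through `star (n k) ξ → T* ξ`,
    -- and, after moving `n k` to the left, through `n k ξ → T ξ`.
    have h1 : Filter.Tendsto (fun k => ⟪S (a ξ), c (star (n k) ξ)⟫_ℂ) Filter.atTop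
        (nhds ⟪T (S (a ξ)), c ξ⟫_ℂ) := by
      rw [hadj T, hTs c hc]
      exact tendsto_const_nhds.inner ((c.continuous.tendsto _).comp hζ)
    have h2 : Filter.Tendsto (fun k => ⟪S (a ξ), c (star (n k) ξ)⟫_ℂ) Filter.atTop
        (nhds ⟪S (T (a ξ)), c ξ⟫_ℂ) := by
      have : ∀ k, ⟪S (a ξ), c (star (n k) ξ)⟫_ℂ = ⟪S (a (n k ξ)), c ξ⟫_ℂ := fun k => by
        rw [hN' _ hc _ (hstar _ (hn k)), ← hadj, hS' _ (hn k), hN' _ (hn k) _ ha]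
      simp only [this]
      rw [← hT' a ha]
      exact (((S * a).continuous.tendsto _).comp hlim1).inner tendsto_const_nhds
    exact tendsto_nhds_unique h2 h1
  exact ContinuousLinearMap.ext hdense

omit [CompleteSpace H] in
theorem mul_smul_eq_smul_mul {S T : H →L[ℂ] H} (h : S * T = T * S) (c : ℂ) :
    S * (c • T) = (c • T) * S := by
  rw [mul_smul_comm, smul_mul_assoc, h]

omit [CompleteSpace H] in
theorem isClosed_commutant (S : H →L[ℂ] H) : IsClosed {T : H →L[ℂ] H | S * T = T * S} :=
  isClosed_eq (continuous_id.const_mul S) (continuous_id.mul_const S)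

/-! ### Commutation with pure partial isometries -/

/-- The coefficients of a power series which vanishes near `0` are zero. -/
theorem _root_.eq_zero_of_hasSum_pow_mul {c : ℕ → ℂ}
    (hc : ∀ z : ℂ, ‖z‖ < 1 → HasSum (fun n => z ^ n * c n) 0) (n : ℕ) : c n = 0 := by
  have h1 : HasFPowerSeriesAt (0 : ℂ → ℂ) (FormalMultilinearSeries.ofScalars ℂ c) 0 := by
    rw [hasFPowerSeriesAt_iff]
    filter_upwards [Metric.ball_mem_nhds (0 : ℂ) one_pos] with z hz
    simpa [FormalMultilinearSeries.coeff_ofScalars] using hc z (by simpa using hz)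
  have h2 := congr($(h1.eq_zero).coeff n)
  rw [FormalMultilinearSeries.coeff_ofScalars] at h2
  rw [h2]
  simp [FormalMultilinearSeries.coeff]

/-- An operator which leaves the closures of the ranges of all `S - z` invariant, where `S` is a
pure partial isometry with `S S* ≤ S* S`, and which commutes with `S* S`, commutes with `S`. -/
theorem mul_comm_of_closure_range_invariant {S e b : H →L[ℂ] H} (hSS : star S * S = e)
    (heS : e * S = S) (hSe : S * e = S) (hbe : b * e = e * b)
    (hb : ∀ z : ℂ, ∀ x ∈ closure (Set.range fun y => S y - z • y),
      b x ∈ closure (Set.range fun y => S y - z • y))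
    (hpure : ∀ η, (∀ j : ℕ, ∃ y, (S ^ j) y = η) → η = 0) : b * S = S * b := by
  have hadj : ∀ (a : H →L[ℂ] H) (x y : H), ⟪a x, y⟫_ℂ = ⟪x, star a y⟫_ℂ := fun a x y => by
    rw [star_eq_adjoint, adjoint_inner_right]
  have hadj' : ∀ (a : H →L[ℂ] H) (x y : H), ⟪star a x, y⟫_ℂ = ⟪x, a y⟫_ℂ := fun a x y => by
    rw [hadj, star_star]
  have hestar : star e = e := by rw [← hSS, star_mul, star_star]
  have hee : e * e = e := by rw [← hSS, mul_assoc, hSS, hSe, hSS]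
  have hSsS : ∀ x, star S (S x) = e x := fun x => congr($hSS x)
  have heSx : ∀ x, e (S x) = S x := fun x => congr($heS x)
  have hSex : ∀ x, S (e x) = S x := fun x => congr($hSe x)
  have heSs : ∀ x, star S (e x) = star S x := fun x => by
    have := congr(star $heS x)
    rwa [star_mul, hestar] at this
  have hSse : ∀ x, e (star S x) = star S x := fun x => by
    have := congr(star $hSe x)
    rwa [star_mul, hestar] at this
  have hnorm : ∀ x, ‖S x‖ ≤ ‖x‖ := by
    have h1 : ‖S‖ * ‖S‖ ≤ 1 := by
      rw [← CStarRing.norm_star_mul_self, hSS]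
      exact IsStarProjection.norm_le e ⟨hee, hestar⟩
    have h2 : ‖S‖ ≤ 1 := by nlinarith [norm_nonneg S]
    exact fun x => (S.le_opNorm x).trans (mul_le_of_le_one_left (norm_nonneg _) h2)
  have hpow : ∀ (j : ℕ) x, ‖(S ^ j) x‖ ≤ ‖x‖ := by
    intro j
    induction j with
    | zero => simp
    | succ j ih => exact fun x => (ih (S x)).trans (hnorm x)
  have hpow_succ : ∀ (j : ℕ) x, (S ^ (j + 1)) x = S ((S ^ j) x) := fun j x => by
    rw [pow_succ']; rfl
  ext ξ
  rw [← sub_eq_zero]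
  set η := (b * S) ξ - (S * b) ξ with hη
  have heη : e η = η := by
    have h1 : e * (b * S - S * b) = b * S - S * b := by
      rw [mul_sub, ← mul_assoc, ← hbe, mul_assoc, heS, ← mul_assoc, heS]
    exact congr($h1 ξ)
  -- Such `k` is orthogonal to the range of `S - z`, while `η = b (S - z) ξ - (S - z) b ξ` is in its
  -- closure.
  have horth : ∀ (z : ℂ) (k : H), star S k = (starRingEnd ℂ z) • k → ⟪k, η⟫_ℂ = 0 := by
    intro z k hk
    have h1 : ∀ x ∈ closure (Set.range fun y => S y - z • y), ⟪k, x⟫_ℂ = 0 := by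
      intro x hx
      refine closure_minimal (t := {x | ⟪k, x⟫_ℂ = 0}) ?_
        (isClosed_eq (by fun_prop) continuous_const) hx
      rintro _ ⟨y, rfl⟩
      change ⟪k, S y - z • y⟫_ℂ = 0
      rw [inner_sub_right, ← hadj', hk, inner_smul_left, inner_smul_right, Complex.conj_conj,
        sub_self]
    have h2 : η = b (S ξ - z • ξ) - (S (b ξ) - z • b ξ) := by
      rw [hη, map_sub, map_smul]
      change b (S ξ) - S (b ξ) = _
      abel
    rw [h2, inner_sub_right, h1 _ (hb z _ (subset_closure ⟨ξ, rfl⟩)),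
      h1 _ (subset_closure ⟨b ξ, rfl⟩), sub_self]
  -- For `|z| < 1` the vector `k = ∑ z^j S^j x` satisfies `S* k = z k`, so `⟪η, k⟫` is a power
  -- series in `z` vanishing on the disc.
  have hcoeff : ∀ x, star S x = 0 → e x = x → ∀ j : ℕ, ⟪η, (S ^ j) x⟫_ℂ = 0 := by
    intro x hx hex
    refine eq_zero_of_hasSum_pow_mul fun z hz => ?_
    have hs : Summable fun j : ℕ => z ^ j • (S ^ j) x := by
      refine Summable.of_norm_bounded
        ((summable_geometric_of_lt_one (norm_nonneg z) hz).mul_right ‖x‖) fun j => ?_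
      rw [norm_smul, norm_pow]
      gcongr
      exact hpow j x
    obtain ⟨k, hk⟩ := hs
    have h1 : HasSum (fun j : ℕ => z ^ (j + 1) • (S ^ j) x) (star S k) := by
      have h2 := hk.mapL (star S)
      rw [← hasSum_nat_add_iff' 1] at h2
      convert h2 using 1
      · ext j
        rw [map_smul, hpow_succ, hSsS]
        congr 1
        cases j with
        | zero => exact hex.symm
        | succ j => rw [hpow_succ, heSx]
      · simp [hx]
    have h2 : star S k = z • k := by
      refine h1.unique ?_
      simpa only [pow_succ', mul_smul] using hk.const_smul z
    have h3 := horth (starRingEnd ℂ z) k (by rw [Complex.conj_conj, h2])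
    have h4 := hk.mapL (innerSL ℂ η)
    rw [innerSL_apply_apply, inner_eq_zero_symm.1 h3] at h4
    simpa [inner_smul_right] using h4
  -- Wold argument: if `η = S^j y`, the part `x = y - S S* y` of `y` in the kernel of `S*` is zero
  -- because `S^j x` is orthogonal to `η`; thus `y` lies in the range of `S`.
  have hrange : ∀ j : ℕ, ∃ y, e y = y ∧ (S ^ j) y = η := by
    intro j
    induction j with
    | zero => exact ⟨η, heη, rfl⟩
    | succ j ih =>
      obtain ⟨y, hey, hy⟩ := ih
      have hpi : ∀ (j : ℕ) (u w : H), e u = u → ⟪(S ^ j) u, (S ^ j) w⟫_ℂ = ⟪u, w⟫_ℂ := by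
        intro j
        induction j with
        | zero => simp
        | succ j ih =>
          intro u w hu
          have h1 : ⟪S u, S w⟫_ℂ = ⟪u, w⟫_ℂ := by
            rw [← hadj', hSsS, hu]
          rw [← h1, ← ih _ _ (heSx u), pow_succ]
          rfl
      set x := y - S (star S y) with hx
      have hx0 : star S x = 0 := by rw [hx, map_sub, hSsS, hSse, sub_self]
      have hex : e x = x := by rw [hx, map_sub, hey, heSx]
      have h1 : ⟪y, x⟫_ℂ = 0 := by
        rw [← hpi j y x hey, hy]
        exact hcoeff x hx0 hex j
      have h2 : ⟪x, x⟫_ℂ = 0 := by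
        nth_rw 1 [hx]
        rw [inner_sub_left, h1, hadj S, hx0, inner_zero_right, sub_zero]
      have h3 : y = S (star S y) := sub_eq_zero.1 (inner_self_eq_zero.1 h2)
      refine ⟨star S y, hSse y, ?_⟩
      rw [← hy, pow_succ]
      exact congrArg (S ^ j) h3.symm
  exact hpure η fun j => (hrange j).imp fun _ h => h.2

end ContinuousLinearMap

end Hilbert

namespace StandardPeriodicSystem

open ContinuousLinearMap

variable {H : Type*} [NormedAddCommGroup H] [InnerProductSpace ℂ H] [CompleteSpace H]
  (D : StandardPeriodicSystem H)

/-! ### The unitary implementation and its strong continuity -/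

section Unitary

theorem U_mul (z w : Circle) (x : H) : D.U (z * w) x = D.U z (D.U w x) := by
  refine congrFun (Continuous.ext_on D.cyclic (D.U (z * w)).continuous
    ((D.U z).continuous.comp (D.U w).continuous) ?_) x
  rintro _ ⟨m, rfl⟩
  simp only [Function.comp_apply, U_apply, map_mul]
  rfl

theorem U_one (x : H) : D.U 1 x = x := by
  refine congrFun (Continuous.ext_on D.cyclic (D.U 1).continuous continuous_id ?_) x
  rintro _ ⟨m, rfl⟩
  simp only [U_apply, map_one]
  rfl

theorem U_U_inv (z : Circle) (x : H) : D.U z (D.U z⁻¹ x) = x := by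
  rw [← U_mul, mul_inv_cancel, U_one]

theorem U_cyclicVector (z : Circle) : D.U z D.ξ₀ = D.ξ₀ := by
  have h := D.U_apply z 1
  rwa [map_one] at h

theorem inner_U_left (z : Circle) (x y : H) : ⟪D.U z x, y⟫_ℂ = ⟪x, D.U z⁻¹ y⟫_ℂ := by
  rw [← (D.U z).inner_map_map x, U_U_inv]

theorem action_apply_U (z : Circle) (m : D.M.toStarSubalgebra) (x : H) :
    (D.α z m : H →L[ℂ] H) (D.U z x) = D.U z ((m : H →L[ℂ] H) x) := by
  refine congrFun (Continuous.ext_on D.cyclic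
    (((D.α z m : H →L[ℂ] H)).continuous.comp (D.U z).continuous)
    ((D.U z).continuous.comp (m : H →L[ℂ] H).continuous) ?_) x
  rintro _ ⟨k, rfl⟩
  have h := D.U_apply z (m * k)
  rw [map_mul] at h
  simp only [Function.comp_apply, U_apply]
  exact h.symm

/-- The unitary `U z` as a bounded operator. -/
def unitaryOp (z : Circle) : H →L[ℂ] H := (D.U z).toContinuousLinearEquiv

@[simp]
theorem unitaryOp_apply (z : Circle) (x : H) : D.unitaryOp z x = D.U z x := rfl

theorem star_unitaryOp (z : Circle) : star (D.unitaryOp z) = D.unitaryOp z⁻¹ := by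
  rw [star_eq_adjoint]
  refine ((eq_adjoint_iff _ _).2 fun x y => ?_).symm
  rw [unitaryOp_apply, unitaryOp_apply, inner_U_left, inv_inv]

/-- Weak continuity on the orbit of `ξ₀` becomes strong continuity because the `U z` preserve norms,
and density of the orbit gives all vectors. -/
theorem continuous_U (x : H) : Continuous fun z : Circle => D.U z x := by
  have weak : ∀ (m : D.M.toStarSubalgebra) (y : H),
      Continuous fun z : Circle => ⟪y, D.U z ((m : H →L[ℂ] H) D.ξ₀)⟫_ℂ := by
    intro m y
    -- One-term sequences turn the σ-weak functional into a single matrix coefficient.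
    have h := D.weakStar_continuous m (fun k => if k = 0 then D.ξ₀ else 0)
      (fun k => if k = 0 then y else 0)
      (summable_of_ne_finset_zero (s := {0}) (by simp +contextual))
      (summable_of_ne_finset_zero (s := {0}) (by simp +contextual))
    convert h using 2 with z
    rw [tsum_eq_single 0 (by simp +contextual), if_pos rfl, if_pos rfl, U_apply]
  have strong : ∀ m : D.M.toStarSubalgebra,
      Continuous fun z : Circle => D.U z ((m : H →L[ℂ] H) D.ξ₀) := by
    intro m
    set v := (m : H →L[ℂ] H) D.ξ₀ with hv
    rw [continuous_iff_continuousAt]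
    intro w
    rw [ContinuousAt, tendsto_iff_norm_sub_tendsto_zero]
    have h1 : ∀ z, ‖D.U z v - D.U w v‖ ^ 2 = 2 * ‖v‖ ^ 2 - 2 * RCLike.re ⟪D.U w v, D.U z v⟫_ℂ := by
      intro z
      rw [@norm_sub_sq ℂ, LinearIsometryEquiv.norm_map, LinearIsometryEquiv.norm_map,
        ← inner_conj_symm, RCLike.conj_re]
      ring
    have h2 : Filter.Tendsto (fun z => ‖D.U z v - D.U w v‖ ^ 2) (nhds w) (nhds 0) := by
      have h3 : Continuous fun z => 2 * ‖v‖ ^ 2 - 2 * RCLike.re ⟪D.U w v, D.U z v⟫_ℂ :=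
        continuous_const.sub (continuous_const.mul (RCLike.continuous_re.comp (weak m _)))
      have h4 := h3.tendsto w
      simp only [← h1] at h4
      simpa using h4
    have h5 := h2.sqrt
    simpa [Real.sqrt_sq] using h5
  rw [continuous_iff_continuousAt]
  intro w
  rw [ContinuousAt, Metric.tendsto_nhds]
  intro ε hε
  obtain ⟨_, hy, ⟨m, rfl⟩⟩ := Metric.dense_iff.1 D.cyclic x (ε / 3) (by positivity)
  filter_upwards [Metric.tendsto_nhds.1 ((strong m).tendsto w) (ε / 3) (by positivity)] with z hz
  rw [Metric.mem_ball, dist_comm] at hy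
  have h1 : dist (D.U z x) (D.U z ((m : H →L[ℂ] H) D.ξ₀)) < ε / 3 := by
    rwa [LinearIsometryEquiv.dist_map]
  have h2 : dist (D.U w ((m : H →L[ℂ] H) D.ξ₀)) (D.U w x) < ε / 3 := by
    rwa [LinearIsometryEquiv.dist_map, dist_comm]
  linarith [dist_triangle4 (D.U z x) (D.U z ((m : H →L[ℂ] H) D.ξ₀))
    (D.U w ((m : H →L[ℂ] H) D.ξ₀)) (D.U w x)]

theorem continuous_U_comp {X : Type*} [TopologicalSpace X] {f : X → Circle} {g : X → H}
    (hf : Continuous f) (hg : Continuous g) : Continuous fun t => D.U (f t) (g t) := by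
  rw [continuous_iff_continuousAt]
  intro s
  have h1 : Filter.Tendsto (fun t => D.U (f t) (g t) - D.U (f t) (g s)) (nhds s) (nhds 0) := by
    have h2 := tendsto_iff_norm_sub_tendsto_zero.1 (hg.tendsto s)
    rw [tendsto_zero_iff_norm_tendsto_zero]
    simpa only [← map_sub, LinearIsometryEquiv.norm_map] using h2
  have h3 := h1.add (((D.continuous_U (g s)).comp hf).tendsto s)
  rw [ContinuousAt]
  simpa using h3

end Unitary

/-! ### Spectral subspaces of `M` and of `H` -/

section Spectral

theorem mem_M_of_commute {a : H →L[ℂ] H} (ha : ∀ T ∈ D.M.commutant, T * a = a * T) :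
    a ∈ D.M := by
  rw [← D.M.commutant_commutant]
  exact VonNeumannAlgebra.mem_commutant_iff.2 ha

theorem commute_of_mem_commutant {a T : H →L[ℂ] H} (ha : a ∈ D.M) (hT : T ∈ D.M.commutant) :
    T * a = a * T :=
  (VonNeumannAlgebra.mem_commutant_iff.1 hT a ha).symm

/-- This form can be checked for operators constructed on `H`, such as polar parts and averages,
before they are known to belong to `M`. -/
theorem mem_spectralSubspace_iff {n : ℤ} {a : H →L[ℂ] H} :
    a ∈ D.spectralSubspace n ↔
      a ∈ D.M ∧ ∀ (z : Circle) (x : H), D.U z (a x) = ((z ^ n : Circle) : ℂ) • a (D.U z x) := by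
  constructor
  · rintro ⟨m, rfl, hm⟩
    refine ⟨m.2, fun z x => ?_⟩
    rw [← action_apply_U, hm]
    rfl
  · rintro ⟨haM, ha⟩
    refine ⟨⟨a, haM⟩, rfl, fun z => Subtype.ext (ContinuousLinearMap.ext fun x => ?_)⟩
    rw [← D.U_U_inv z x, action_apply_U]
    exact ha z _

theorem spectralSubspace_subset (n : ℤ) {a : H →L[ℂ] H} (ha : a ∈ D.spectralSubspace n) :
    a ∈ D.M := (D.mem_spectralSubspace_iff.1 ha).1

theorem mul_mem_spectralSubspace {n k : ℤ} {a b : H →L[ℂ] H} (ha : a ∈ D.spectralSubspace n)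
    (hb : b ∈ D.spectralSubspace k) : a * b ∈ D.spectralSubspace (n + k) := by
  rw [mem_spectralSubspace_iff] at *
  refine ⟨mul_mem ha.1 hb.1, fun z x => ?_⟩
  change D.U z (a (b x)) = _ • a (b (D.U z x))
  rw [ha.2, hb.2, map_smul, smul_smul, ← Circle.coe_mul, ← zpow_add]

theorem star_mem_spectralSubspace {n : ℤ} {a : H →L[ℂ] H} (ha : a ∈ D.spectralSubspace n) :
    star a ∈ D.spectralSubspace (-n) := by
  rw [mem_spectralSubspace_iff] at *
  refine ⟨star_mem ha.1, fun z x => ext_inner_left ℂ fun y => ?_⟩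
  have h1 : ∀ u w : H, ⟪u, (star a) w⟫_ℂ = ⟪a u, w⟫_ℂ := fun u w => by
    rw [star_eq_adjoint, adjoint_inner_right]
  have h2 := D.inner_U_left z⁻¹ y (star a x)
  rw [inv_inv] at h2
  have h3 := D.inner_U_left z⁻¹ (a y) x
  rw [inv_inv, ha.2, inner_smul_left] at h3
  have h4 : (starRingEnd ℂ) ((z⁻¹ ^ n : Circle) : ℂ) = ((z ^ n : Circle) : ℂ) := by
    rw [inv_zpow, Circle.coe_inv_eq_conj, Complex.conj_conj]
  rw [h4] at h3
  rw [← h2, h1, inner_smul_right, h1, ← h3, ← mul_assoc, zpow_neg, ← Circle.coe_mul,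
    inv_mul_cancel, Circle.coe_one, one_mul]

/-- The commutant of the von Neumann algebra, together with the unitaries `U z`. -/
def fixedCommutant : Set (H →L[ℂ] H) := (D.M.commutant : Set (H →L[ℂ] H)) ∪ Set.range D.unitaryOp

theorem star_mem_fixedCommutant {T : H →L[ℂ] H} (hT : T ∈ D.fixedCommutant) :
    star T ∈ D.fixedCommutant := by
  rcases hT with hT | ⟨z, rfl⟩
  · exact Or.inl (star_mem (S := VonNeumannAlgebra H) hT)
  · exact Or.inr ⟨z⁻¹, (D.star_unitaryOp z).symm⟩

/-- Writing `M_0` as the commutant of a self-adjoint set gives access to moduli, range projections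
and `mem_of_projections_mem`. -/
theorem mem_spectralSubspace_zero_iff {a : H →L[ℂ] H} :
    a ∈ D.spectralSubspace 0 ↔ a ∈ D.fixedCommutant.centralizer := by
  rw [mem_spectralSubspace_iff]
  constructor
  · rintro ⟨haM, ha⟩ T (hT | ⟨z, rfl⟩)
    · exact D.commute_of_mem_commutant haM hT
    · ext x
      simpa using ha z x
  · intro ha
    refine ⟨D.mem_M_of_commute fun T hT => ha T (Or.inl hT), fun z x => ?_⟩
    simpa using congr($(ha _ (Or.inr ⟨z, rfl⟩)) x)

theorem one_mem_spectralSubspace_zero : (1 : H →L[ℂ] H) ∈ D.spectralSubspace 0 :=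
  D.mem_spectralSubspace_zero_iff.2 fun T _ => by rw [mul_one, one_mul]

/-- Since `m* m` has degree zero, so does `|m|`; the polar part then inherits the degree of `m` by
`polar_semicommute`. -/
theorem exists_polar_mem_spectralSubspace {n : ℤ} {m : H →L[ℂ] H}
    (hm : m ∈ D.spectralSubspace n) :
    ∃ v ∈ D.spectralSubspace n, ∃ h ∈ D.spectralSubspace 0, v * h = m ∧
      star v * v * h = h ∧ v * (star v * v) = v := by
  obtain ⟨v, hvh, hve, hvv⟩ := exists_polar_decomposition m
  have hmM := D.spectralSubspace_subset n hm
  have hmm : star m * m ∈ D.spectralSubspace 0 := by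
    simpa using D.mul_mem_spectralSubspace (D.star_mem_spectralSubspace hm) hm
  have hh : m.modulus ∈ D.fixedCommutant.centralizer := fun T hT =>
    commute_modulus (D.mem_spectralSubspace_zero_iff.1 hmm T hT)
  refine ⟨v, ?_, m.modulus, D.mem_spectralSubspace_zero_iff.2 hh, hvh, ?_, ?_⟩
  · rw [mem_spectralSubspace_iff]
    have semi : ∀ T ∈ D.fixedCommutant, ∀ c : ℂ, T * m = c • (m * T) → T * v = c • (v * T) :=
      fun T hT c hc => polar_semicommute hvh hve hc (hh T hT)
        (hh _ (D.star_mem_fixedCommutant hT))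
    constructor
    · refine D.mem_M_of_commute fun T hT => ?_
      simpa using semi T (Or.inl hT) 1 (by simpa using D.commute_of_mem_commutant hmM hT)
    · intro z x
      exact congr($(semi _ (Or.inr ⟨z, rfl⟩) _
        (ContinuousLinearMap.ext fun y => (D.mem_spectralSubspace_iff.1 hm).2 z y)) x)
  · rw [hvv, rangeProj_mul]
  · rw [hvv, hve]

theorem spectralSubspace_map_hilbertSpectralSubspace {n k : ℤ} {a : H →L[ℂ] H}
    (ha : a ∈ D.spectralSubspace n) {x : H} (hx : x ∈ D.hilbertSpectralSubspace k) :
    a x ∈ D.hilbertSpectralSubspace (n + k) := by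
  intro z
  rw [(D.mem_spectralSubspace_iff.1 ha).2, hx z, map_smul, smul_smul, ← Circle.coe_mul,
    ← zpow_add]

theorem cyclicVector_mem : D.ξ₀ ∈ D.hilbertSpectralSubspace 0 := fun z => by
  simp [U_cyclicVector]

theorem apply_cyclicVector_mem {n : ℤ} {a : H →L[ℂ] H} (ha : a ∈ D.spectralSubspace n) :
    a D.ξ₀ ∈ D.hilbertSpectralSubspace n := by
  simpa using D.spectralSubspace_map_hilbertSpectralSubspace ha D.cyclicVector_mem

theorem isClosed_hilbertSpectralSubspace (n : ℤ) :
    IsClosed (D.hilbertSpectralSubspace n : Set H) := by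
  have : (D.hilbertSpectralSubspace n : Set H) =
      ⋂ z : Circle, {ξ | D.U z ξ = ((z ^ n : Circle) : ℂ) • ξ} := by
    ext ξ
    simp only [Set.mem_iInter]
    rfl
  rw [this]
  exact isClosed_iInter fun z => isClosed_eq (D.U z).continuous (by fun_prop)

theorem exists_zpow_ne_one {n : ℤ} (hn : n ≠ 0) : ∃ z : Circle, z ^ n ≠ 1 := by
  refine ⟨Circle.exp (Real.pi / n), fun h => ?_⟩
  have h1 : Circle.exp (Real.pi / n) ^ n = Circle.exp Real.pi := by
    rw [← Circle.exp_zsmul, zsmul_eq_mul, mul_div_cancel₀ _ (by exact_mod_cast hn)]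
  rw [h1] at h
  have h2 := congrArg (fun w : Circle => (w : ℂ)) h
  norm_num [Circle.coe_exp, Complex.exp_pi_mul_I] at h2

theorem inner_eq_zero_of_ne {n k : ℤ} (hnk : n ≠ k) {x y : H}
    (hx : x ∈ D.hilbertSpectralSubspace n) (hy : y ∈ D.hilbertSpectralSubspace k) :
    ⟪x, y⟫_ℂ = 0 := by
  obtain ⟨z, hz⟩ := exists_zpow_ne_one (sub_ne_zero.2 hnk)
  have h1 := (D.U z).inner_map_map x y
  rw [hx z, hy z, inner_smul_left, inner_smul_right, ← Circle.coe_inv_eq_conj, ← mul_assoc,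
    ← Circle.coe_mul] at h1
  by_contra h2
  have h3 := mul_right_cancel₀ h2 (h1.trans (one_mul _).symm)
  refine hz ?_
  have h4 : (z ^ n)⁻¹ * z ^ k = 1 := Subtype.ext h3
  rw [zpow_sub, inv_mul_eq_one.1 h4, mul_inv_cancel]

end Spectral

end StandardPeriodicSystem

namespace StandardPeriodicSystem

open ContinuousLinearMap MeasureTheory AddCircle

variable {H : Type*} [NormedAddCommGroup H] [InnerProductSpace ℂ H] [CompleteSpace H]
  (D : StandardPeriodicSystem H)

/-! ### Fourier coefficients and averaging over the circle -/

section Average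

/-- The orbit of the operator `a` under conjugation by the unitaries `U`, applied to `x`. -/
def conjOrbit (a : H →L[ℂ] H) (x : H) (t : UnitAddCircle) : H :=
  D.U t.toCircle (a (D.U t.toCircle⁻¹ x))

theorem continuous_conjOrbit (a : H →L[ℂ] H) (x : H) : Continuous (D.conjOrbit a x) :=
  D.continuous_U_comp continuous_toCircle
    (a.continuous.comp ((D.continuous_U x).comp continuous_toCircle.inv))

theorem norm_conjOrbit_le (a : H →L[ℂ] H) (x : H) (t : UnitAddCircle) :
    ‖D.conjOrbit a x t‖ ≤ ‖a‖ * ‖x‖ := by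
  rw [conjOrbit, LinearIsometryEquiv.norm_map]
  exact (a.le_opNorm _).trans_eq (by rw [LinearIsometryEquiv.norm_map])

theorem integrable_smul_conjOrbit (f : C(UnitAddCircle, ℂ)) (a : H →L[ℂ] H) (x : H) :
    Integrable (fun t => f t • D.conjOrbit a x t) haarAddCircle :=
  (f.continuous.smul (D.continuous_conjOrbit a x)).integrable_of_hasCompactSupport
    (HasCompactSupport.of_compactSpace _)

/-- The average `∫ f(t) U t a (U t)⁻¹ dt` of the orbit of `a`, weighted by `f`. -/
def average (a : H →L[ℂ] H) : C(UnitAddCircle, ℂ) →L[ℂ] (H →L[ℂ] H) :=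
  (LinearMap.mk₂ ℂ (fun (f : C(UnitAddCircle, ℂ)) x => ∫ t, f t • D.conjOrbit a x t ∂haarAddCircle)
    (fun f g x => by
      rw [← integral_add (D.integrable_smul_conjOrbit f a x) (D.integrable_smul_conjOrbit g a x)]
      simp only [ContinuousMap.add_apply, add_smul])
    (fun c f x => by
      rw [← integral_smul]
      simp only [ContinuousMap.smul_apply, smul_eq_mul, mul_smul])
    (fun f x y => by
      rw [← integral_add (D.integrable_smul_conjOrbit f a x) (D.integrable_smul_conjOrbit f a y)]
      simp only [conjOrbit, map_add, smul_add])
    (fun c f x => by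
      rw [← integral_smul]
      simp only [conjOrbit, map_smul, smul_comm c])).mkContinuous₂ ‖a‖ (fun f x => by
        have h := norm_integral_le_of_norm_le_const (μ := haarAddCircle) (C := ‖a‖ * ‖f‖ * ‖x‖)
          (f := fun t => f t • D.conjOrbit a x t) (.of_forall fun t => by
            rw [norm_smul, mul_comm ‖a‖, mul_assoc]
            gcongr
            · exact f.norm_coe_le_norm t
            · exact D.norm_conjOrbit_le a x t)
        simpa using h)

theorem average_apply (a : H →L[ℂ] H) (f : C(UnitAddCircle, ℂ)) (x : H) :
    D.average a f x = ∫ t, f t • D.conjOrbit a x t ∂haarAddCircle := rfl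

theorem average_mem_M {a : H →L[ℂ] H} (ha : a ∈ D.M) (f : C(UnitAddCircle, ℂ)) :
    D.average a f ∈ D.M := by
  refine D.mem_M_of_commute fun T hT => ContinuousLinearMap.ext fun x => ?_
  change T (D.average a f x) = D.average a f (T x)
  rw [average_apply, average_apply, ← integral_comp_comm T (D.integrable_smul_conjOrbit f a x)]
  refine integral_congr_ae (.of_forall fun t => ?_)
  have hmem : (D.α t.toCircle ⟨a, ha⟩ : H →L[ℂ] H) ∈ D.M := (D.α t.toCircle ⟨a, ha⟩).2
  have h1 : ∀ y, D.conjOrbit a y t = (D.α t.toCircle ⟨a, ha⟩ : H →L[ℂ] H) y := fun y => by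
    rw [conjOrbit, ← D.action_apply_U t.toCircle ⟨a, ha⟩, U_U_inv]
  change T (f t • D.conjOrbit a x t) = f t • D.conjOrbit a (T x) t
  rw [map_smul, h1, h1]
  exact congrArg (f t • ·) congr($(D.commute_of_mem_commutant hmem hT) x)

theorem toCircle_surjective : Function.Surjective (toCircle : UnitAddCircle → Circle) := fun z => by
  obtain ⟨t, rfl⟩ := (AddCircle.homeomorphCircle (T := 1) one_ne_zero).surjective z
  exact ⟨t, (AddCircle.homeomorphCircle_apply one_ne_zero t).symm⟩

/-- The `n`-th Fourier coefficient of `a` with respect to the action. -/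
def fourierPart (a : H →L[ℂ] H) (n : ℤ) : H →L[ℂ] H := D.average a (fourier (-n))

theorem fourierPart_mem {a : H →L[ℂ] H} (ha : a ∈ D.M) (n : ℤ) :
    D.fourierPart a n ∈ D.spectralSubspace n := by
  refine D.mem_spectralSubspace_iff.2 ⟨D.average_mem_M ha _, fun z x => ?_⟩
  obtain ⟨s, rfl⟩ := toCircle_surjective z
  change D.unitaryOp _ _ = _
  rw [fourierPart, average_apply, average_apply,
    ← integral_comp_comm _ (D.integrable_smul_conjOrbit _ a x), ← integral_smul,
    -- Haar invariance: translating by `s` pulls `U s` out of the orbit and the factor `s ^ (-n)`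
    -- out of the character.
    ← integral_add_left_eq_self (fun t => _ • _ • D.conjOrbit a (D.U s.toCircle x) t) s]
  refine integral_congr_ae (.of_forall fun t => ?_)
  have h1 : D.conjOrbit a (D.U s.toCircle x) (s + t) = D.U s.toCircle (D.conjOrbit a x t) := by
    rw [conjOrbit, conjOrbit, toCircle_add, mul_inv_rev, ← U_mul, ← U_mul, inv_mul_cancel_right]
  have h2 : (fourier (-n) (s + t) : ℂ) = ((s.toCircle ^ (-n) : Circle) : ℂ) * fourier (-n) t := by
    rw [fourier_apply, fourier_apply, smul_add, toCircle_add, toCircle_zsmul, Circle.coe_mul]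
  simp only [h1, h2, map_smul, unitaryOp_apply]
  rw [smul_smul, ← mul_assoc, ← Circle.coe_mul, ← zpow_add, add_neg_cancel, zpow_zero,
    Circle.coe_one, one_mul]

/-- The average is norm continuous in its weight, and characters span a dense subspace of the
continuous functions. -/
theorem average_mem_of_fourierPart_mem {a : H →L[ℂ] H} (W : Submodule ℂ (H →L[ℂ] H))
    (hW : IsClosed (W : Set (H →L[ℂ] H))) (ha : ∀ n, D.fourierPart a n ∈ W)
    (f : C(UnitAddCircle, ℂ)) : D.average a f ∈ W := by
  have h1 : f ∈ (Submodule.span ℂ (Set.range (fourier (T := 1)))).topologicalClosure := by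
    rw [span_fourier_closure_eq_top]
    trivial
  refine closure_minimal (t := D.average a ⁻¹' W) ?_ (hW.preimage (D.average a).continuous) h1
  intro g hg
  have h2 : Submodule.span ℂ (Set.range (fourier (T := 1))) ≤
      W.comap (D.average a : C(UnitAddCircle, ℂ) →ₗ[ℂ] H →L[ℂ] H) := by
    rw [Submodule.span_le]
    rintro _ ⟨n, rfl⟩
    have h3 := ha (-n)
    rwa [fourierPart, neg_neg] at h3
  exact h2 hg

/-- Weights on the circle which concentrate at `0`. -/
theorem exists_approximate_identity : ∃ f : ℕ → C(UnitAddCircle, ℂ), ∀ g : UnitAddCircle → H,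
    Continuous g → Filter.Tendsto (fun n => ∫ t, f n t • g t ∂haarAddCircle) Filter.atTop
      (nhds (g 0)) := by
  -- The weights are normalised powers of a function with a strict maximum at `0`.
  let c : UnitAddCircle → ℝ := fun t => Real.exp (-‖t‖)
  have hc : Continuous c := by fun_prop
  let f : ℕ → C(UnitAddCircle, ℂ) := fun n =>
    ⟨fun t => (((∫ s, c s ^ n ∂haarAddCircle)⁻¹ * c t ^ n : ℝ) : ℂ), by fun_prop⟩
  refine ⟨f, fun g hg => ?_⟩
  have h := tendsto_setIntegral_pow_smul_of_unique_maximum_of_isCompact_of_continuousOn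
    (μ := haarAddCircle (T := 1)) (g := g) (x₀ := 0) (s := Set.univ) (c := c) isCompact_univ
    hc.continuousOn (fun y _ hy => by simpa [c] using hy) (fun y _ => (Real.exp_pos _).le)
    (Real.exp_pos _) (by simp) hg.continuousOn
  simp only [Measure.restrict_univ] at h
  convert h using 2 with n
  rw [← integral_smul]
  refine integral_congr_ae (.of_forall fun t => ?_)
  simp only [f, ContinuousMap.coe_mk]
  rw [smul_smul, Complex.coe_smul]

theorem exists_tendsto_average : ∃ f : ℕ → C(UnitAddCircle, ℂ), ∀ (a : H →L[ℂ] H) (x : H),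
    Filter.Tendsto (fun n => D.average a (f n) x) Filter.atTop (nhds (a x)) := by
  obtain ⟨f, hf⟩ := exists_approximate_identity (H := H)
  refine ⟨f, fun a x => ?_⟩
  have h := hf _ (D.continuous_conjOrbit a x)
  rwa [conjOrbit, toCircle_zero, inv_one, U_one, U_one] at h

end Average

/-! ### Density of trigonometric polynomials and analytic symbols -/

section Density

/-- The linear span of the spectral subspaces of `M`. -/
def trigPolynomials : Submodule ℂ (H →L[ℂ] H) :=
  Submodule.span ℂ (⋃ n : ℤ, D.spectralSubspace n)

theorem mem_trigPolynomials {n : ℤ} {a : H →L[ℂ] H} (ha : a ∈ D.spectralSubspace n) :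
    a ∈ D.trigPolynomials :=
  Submodule.subset_span (Set.mem_iUnion.2 ⟨n, ha⟩)

theorem trigPolynomials_induction {p : (H →L[ℂ] H) → Prop}
    (mem : ∀ n, ∀ a ∈ D.spectralSubspace n, p a) (zero : p 0)
    (add : ∀ a b, p a → p b → p (a + b)) (smul : ∀ (c : ℂ) a, p a → p (c • a))
    {a : H →L[ℂ] H} (ha : a ∈ D.trigPolynomials) : p a := by
  refine Submodule.span_induction (p := fun a _ => p a) ?_ zero (fun a b _ _ => add a b)
    (fun c a _ => smul c a) ha
  intro a ha
  obtain ⟨n, hn⟩ := Set.mem_iUnion.1 ha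
  exact mem n a hn

theorem trigPolynomials_subset {a : H →L[ℂ] H} (ha : a ∈ D.trigPolynomials) : a ∈ D.M :=
  D.trigPolynomials_induction (p := fun a => a ∈ D.M) (fun n _ h => D.spectralSubspace_subset n h)
    (zero_mem _) (fun _ _ => add_mem)
    (fun c _ h => D.M.toStarSubalgebra.toSubalgebra.smul_mem h c) ha

theorem star_mem_trigPolynomials {a : H →L[ℂ] H} (ha : a ∈ D.trigPolynomials) :
    star a ∈ D.trigPolynomials :=
  D.trigPolynomials_induction (p := fun a => star a ∈ D.trigPolynomials)
    (fun _ _ h => D.mem_trigPolynomials (D.star_mem_spectralSubspace h))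
    (by rw [star_zero]; exact zero_mem _)
    (fun _ _ h h' => by rw [star_add]; exact add_mem h h')
    (fun c _ h => by rw [star_smul]; exact Submodule.smul_mem _ _ h) ha

theorem dense_trigPolynomials : Dense ((fun a : H →L[ℂ] H => a D.ξ₀) '' D.trigPolynomials) := by
  obtain ⟨f, hf⟩ := D.exists_tendsto_average
  have h1 : Set.range D.orbitMap ⊆
      closure ((fun a : H →L[ℂ] H => a D.ξ₀) '' D.trigPolynomials) := by
    rintro _ ⟨m, rfl⟩
    refine isClosed_closure.mem_of_tendsto (hf (m : H →L[ℂ] H) D.ξ₀) (.of_forall fun n => ?_)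
    have h2 : D.average (m : H →L[ℂ] H) (f n) ∈ D.trigPolynomials.topologicalClosure :=
      D.average_mem_of_fourierPart_mem _ (Submodule.isClosed_topologicalClosure _)
        (fun k => Submodule.le_topologicalClosure _
          (D.mem_trigPolynomials (D.fourierPart_mem m.2 k))) _
    exact image_closure_subset_closure_image (f := fun a : H →L[ℂ] H => a D.ξ₀) (by fun_prop)
      ⟨_, h2, rfl⟩
  intro x
  exact closure_minimal h1 isClosed_closure (D.denseRange_orbitMap x)

/-- `M_n ξ₀` spans a dense subspace of `H_n`. -/
theorem hilbertSpectralSubspace_le (n : ℤ) : D.hilbertSpectralSubspace n ≤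
    (Submodule.span ℂ ((fun a : H →L[ℂ] H => a D.ξ₀) '' D.spectralSubspace n)).topologicalClosure := by
  set K := (Submodule.span ℂ
    ((fun a : H →L[ℂ] H => a D.ξ₀) '' D.spectralSubspace n)).topologicalClosure with hK
  have hKn : K ≤ D.hilbertSpectralSubspace n := by
    refine Submodule.topologicalClosure_minimal _ ?_ (D.isClosed_hilbertSpectralSubspace n)
    rw [Submodule.span_le]
    rintro _ ⟨a, ha, rfl⟩
    exact D.apply_cyclicVector_mem ha
  have : CompleteSpace K := (Submodule.isClosed_topologicalClosure _).completeSpace_coe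
  intro x hx
  -- This difference is orthogonal to `M_n ξ₀` by projection and to the other `M_k ξ₀` by
  -- orthogonality of degrees, hence to a dense set.
  have h1 : x - K.starProjection x = 0 := by
    have hmem : x - K.starProjection x ∈ D.hilbertSpectralSubspace n :=
      sub_mem hx (hKn (Submodule.starProjection_apply_mem _ x))
    refine D.dense_trigPolynomials.eq_zero_of_inner_left ℂ ?_
    rintro _ ⟨a, ha, rfl⟩
    refine D.trigPolynomials_induction (p := fun a => ⟪x - K.starProjection x, a D.ξ₀⟫_ℂ = 0)
      ?_ (by simp) ?_ ?_ ha
    · intro k a ha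
      by_cases hkn : n = k
      · subst hkn
        have h2 : a D.ξ₀ ∈ K := Submodule.le_topologicalClosure _
          (Submodule.subset_span ⟨a, ha, rfl⟩)
        exact Submodule.inner_left_of_mem_orthogonal h2
          (Submodule.sub_starProjection_mem_orthogonal x)
      · exact D.inner_eq_zero_of_ne hkn hmem (D.apply_cyclicVector_mem ha)
    · intro a b ha hb
      rw [add_apply, inner_add_right, ha, hb, add_zero]
    · intro c a ha
      rw [smul_apply, inner_smul_right, ha, mul_zero]
  rw [sub_eq_zero.1 h1]
  exact Submodule.starProjection_apply_mem _ x

theorem hilbertSpectralSubspace_le_hardySpace (n : ℕ) :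
    D.hilbertSpectralSubspace n ≤ D.hardySpace :=
  (le_iSup (fun n : ℕ => D.hilbertSpectralSubspace n) n).trans (Submodule.le_topologicalClosure _)

/-- A closed subspace which contains the `H_n`, `n ≥ 0`, contains `H₊`. -/
theorem hardySpace_le {K : Submodule ℂ H} (hK : IsClosed (K : Set H))
    (h : ∀ n : ℕ, D.hilbertSpectralSubspace n ≤ K) : D.hardySpace ≤ K :=
  Submodule.topologicalClosure_minimal _ (iSup_le h) hK

theorem cyclicVector_mem_hardySpace : D.ξ₀ ∈ D.hardySpace :=
  D.hilbertSpectralSubspace_le_hardySpace 0 D.cyclicVector_mem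

/-- The vector `a_n ξ₀` is the component of `a ξ₀` in `H_n`, which is orthogonal to `H₊` for `n <
0`; `ξ₀` separates `M`. -/
theorem fourierPart_eq_zero {a : H →L[ℂ] H} (ha : a ∈ D.M) (haξ : a D.ξ₀ ∈ D.hardySpace)
    {n : ℤ} (hn : n < 0) : D.fourierPart a n = 0 := by
  have hmem := D.fourierPart_mem ha n
  have hx := D.apply_cyclicVector_mem hmem
  set x := D.fourierPart a n D.ξ₀ with hxdef
  have horth : ∀ y ∈ D.hilbertSpectralSubspace n, ⟪y, a D.ξ₀⟫_ℂ = 0 := by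
    intro y hy
    refine D.hardySpace_le (K := LinearMap.ker (innerSL ℂ y : H →ₗ[ℂ] ℂ)) ?_ ?_ haξ
    · exact (innerSL ℂ y).isClosed_ker
    · intro k w hw
      exact D.inner_eq_zero_of_ne (by omega) hy hw
  have h1 : ⟪x, x⟫_ℂ = 0 := by
    nth_rw 2 [hxdef]
    rw [fourierPart, average_apply, ← integral_inner (D.integrable_smul_conjOrbit _ a _)]
    refine integral_eq_zero_of_ae (.of_forall fun t => ?_)
    simp only [conjOrbit, U_cyclicVector, Pi.zero_apply]
    have h2 := D.inner_U_left t.toCircle⁻¹ x (a D.ξ₀)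
    rw [inv_inv] at h2
    rw [inner_smul_right, ← h2, hx, inner_smul_left, horth x hx, mul_zero, mul_zero]
  have h2 := D.separating ⟨_, D.spectralSubspace_subset n hmem⟩ (inner_self_eq_zero.1 h1)
  exact congrArg Subtype.val h2

end Density

/-! ### The analytic algebra generated by nonnegative degrees -/

section AnalyticAlgebra

omit [CompleteSpace H] in
theorem subset_wotClosedAlgebra (S : Set (H →L[ℂ] H)) :
    S ⊆ (wotClosedAlgebra S : Set (H →L[ℂ] H)) := fun _ ha => by
  simp only [wotClosedAlgebra, SetLike.mem_coe, Algebra.mem_sInf]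
  exact fun A hA => hA.1 ha

omit [CompleteSpace H] in
theorem wotClosedAlgebra_le {S : Set (H →L[ℂ] H)} {A : Subalgebra ℂ (H →L[ℂ] H)} (hS : S ⊆ A)
    (hA : IsClosed {T : H →WOT[ℂ] H | T.toCLM ∈ A}) : wotClosedAlgebra S ≤ A :=
  sInf_le ⟨hS, hA⟩

omit [CompleteSpace H] in
theorem isClosed_wotClosedAlgebra (S : Set (H →L[ℂ] H)) :
    IsClosed {T : H →WOT[ℂ] H | T.toCLM ∈ wotClosedAlgebra S} := by
  have : {T : H →WOT[ℂ] H | T.toCLM ∈ wotClosedAlgebra S} =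
      ⋂ A ∈ {A : Subalgebra ℂ (H →L[ℂ] H) | S ⊆ A ∧ IsClosed {T : H →WOT[ℂ] H | T.toCLM ∈ A}},
        {T : H →WOT[ℂ] H | T.toCLM ∈ A} := by
    ext T
    simp [wotClosedAlgebra, Algebra.mem_sInf]
  rw [this]
  exact isClosed_biInter fun A hA => hA.2

omit [CompleteSpace H] in
theorem mem_wotClosedAlgebra_of_tendsto {S : Set (H →L[ℂ] H)} {T : ℕ → H →L[ℂ] H} {a : H →L[ℂ] H}
    (hT : ∀ n, T n ∈ wotClosedAlgebra S)
    (h : ∀ x, Filter.Tendsto (fun n => T n x) Filter.atTop (nhds (a x))) :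
    a ∈ wotClosedAlgebra S := by
  have hlim : Filter.Tendsto (fun n => ContinuousLinearMapWOT.ofCLM (T n)) Filter.atTop
      (nhds (ContinuousLinearMapWOT.ofCLM a)) := by
    rw [ContinuousLinearMapWOT.tendsto_iff_forall_dual_apply_tendsto]
    exact fun x y => (y.continuous.tendsto _).comp (h x)
  exact (isClosed_wotClosedAlgebra S).mem_of_tendsto hlim (.of_forall hT)

omit [CompleteSpace H] in
theorem isClosed_of_mem_wotClosedAlgebra (S : Set (H →L[ℂ] H)) :
    IsClosed (wotClosedAlgebra S : Set (H →L[ℂ] H)) :=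
  (isClosed_wotClosedAlgebra S).preimage ContinuousLinearMapWOT.continuous_ofCLM

/-- The weak operator closed algebra generated by the `M_n`, `n ≥ 0`. -/
def nonnegAlgebra : Subalgebra ℂ (H →L[ℂ] H) :=
  wotClosedAlgebra (⋃ n : ℕ, D.spectralSubspace n)

theorem mem_nonnegAlgebra {n : ℕ} {a : H →L[ℂ] H} (ha : a ∈ D.spectralSubspace n) :
    a ∈ D.nonnegAlgebra :=
  subset_wotClosedAlgebra _ (Set.mem_iUnion.2 ⟨n, ha⟩)

/-- The elements of `M` with analytic symbol belong to the algebra generated by the `M_n`,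
`n ≥ 0`. -/
theorem mem_nonnegAlgebra_of_apply_mem {a : H →L[ℂ] H} (ha : a ∈ D.M)
    (haξ : a D.ξ₀ ∈ D.hardySpace) : a ∈ D.nonnegAlgebra := by
  obtain ⟨f, hf⟩ := D.exists_tendsto_average
  refine mem_wotClosedAlgebra_of_tendsto (fun n => ?_) (hf a)
  refine D.average_mem_of_fourierPart_mem D.nonnegAlgebra.toSubmodule
    (isClosed_of_mem_wotClosedAlgebra _) (fun k => ?_) (f n)
  rcases lt_or_ge k 0 with hk | hk
  · rw [D.fourierPart_eq_zero ha haξ hk]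
    exact zero_mem _
  · lift k to ℕ using hk
    exact D.mem_nonnegAlgebra (D.fourierPart_mem ha k)

end AnalyticAlgebra

end StandardPeriodicSystem

namespace StandardPeriodicSystem

open ContinuousLinearMap

variable {H : Type*} [NormedAddCommGroup H] [InnerProductSpace ℂ H] [CompleteSpace H]
  (D : StandardPeriodicSystem H)

/-! ### Compression to `H₊` -/

section NonnegAlgebra

/-- The subalgebra of the operators which leave `K` invariant. -/
def stabilizerAlgebra (K : Submodule ℂ H) : Subalgebra ℂ (H →L[ℂ] H) where
  carrier := {T | ∀ x ∈ K, T x ∈ K}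
  mul_mem' hS hT x hx := hS _ (hT x hx)
  add_mem' hS hT x hx := K.add_mem (hS x hx) (hT x hx)
  algebraMap_mem' c x hx := by
    rw [Algebra.algebraMap_eq_smul_one]
    exact K.smul_mem c hx

-- As `K = Kᗮᗮ`, invariance of `K` is the vanishing of weakly continuous matrix coefficients.
omit [CompleteSpace H] in
theorem isClosed_stabilizerAlgebra (K : Submodule ℂ H) [CompleteSpace K] :
    IsClosed {T : H →WOT[ℂ] H | T.toCLM ∈ stabilizerAlgebra K} := by
  have : {T : H →WOT[ℂ] H | T.toCLM ∈ stabilizerAlgebra K} =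
      ⋂ x ∈ K, ⋂ y ∈ Kᗮ, {T | innerSL ℂ y (T x) = 0} := by
    ext T
    simp only [Set.mem_iInter]
    refine forall₂_congr fun x hx => ?_
    rw [← K.orthogonal_orthogonal, Submodule.mem_orthogonal, K.orthogonal_orthogonal]
    rfl
  rw [this]
  exact isClosed_biInter fun x _ => isClosed_biInter fun y _ =>
    isClosed_eq (ContinuousLinearMapWOT.continuous_dual_apply x (innerSL ℂ y)) continuous_const

omit [CompleteSpace H] in
theorem isClosed_centralizer (S : Set (H →L[ℂ] H)) :
    IsClosed {T : H →WOT[ℂ] H | T.toCLM ∈ Subalgebra.centralizer ℂ S} := by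
  have : {T : H →WOT[ℂ] H | T.toCLM ∈ Subalgebra.centralizer ℂ S} =
      ⋂ R ∈ S, ⋂ x : H, ⋂ y : H, {T | (innerSL ℂ y ∘L R) (T x) = innerSL ℂ y (T (R x))} := by
    ext T
    simp only [Set.mem_iInter]
    refine forall₂_congr fun R hR => ?_
    constructor
    · intro h x y
      exact congr(innerSL ℂ y ($h x))
    · intro h
      ext x
      exact ext_inner_left ℂ (h x)
  rw [this]
  exact isClosed_biInter fun R _ => isClosed_iInter fun x => isClosed_iInter fun y =>
    isClosed_eq (ContinuousLinearMapWOT.continuous_dual_apply x _)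
      (ContinuousLinearMapWOT.continuous_dual_apply (R x) _)

theorem spectralSubspace_map_hardySpace {n : ℕ} {a : H →L[ℂ] H}
    (ha : a ∈ D.spectralSubspace n) {x : H} (hx : x ∈ D.hardySpace) : a x ∈ D.hardySpace := by
  refine D.hardySpace_le (K := D.hardySpace.comap (a : H →ₗ[ℂ] H)) ?_ ?_ hx
  · exact (Submodule.isClosed_topologicalClosure _).preimage a.continuous
  · intro k y hy
    have h := D.spectralSubspace_map_hilbertSpectralSubspace ha hy
    rw [← Nat.cast_add] at h
    exact D.hilbertSpectralSubspace_le_hardySpace _ h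

theorem nonnegAlgebra_map_hardySpace {a : H →L[ℂ] H} (ha : a ∈ D.nonnegAlgebra) {x : H}
    (hx : x ∈ D.hardySpace) : a x ∈ D.hardySpace := by
  refine wotClosedAlgebra_le (A := stabilizerAlgebra D.hardySpace) ?_
    (isClosed_stabilizerAlgebra _) ha x hx
  refine Set.iUnion_subset fun n a ha x hx => D.spectralSubspace_map_hardySpace ha hx

theorem nonnegAlgebra_subset {a : H →L[ℂ] H} (ha : a ∈ D.nonnegAlgebra) : a ∈ D.M := by
  refine D.mem_M_of_commute ?_
  refine wotClosedAlgebra_le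
    (A := Subalgebra.centralizer ℂ (D.M.commutant : Set (H →L[ℂ] H))) ?_ (isClosed_centralizer _) ha
  exact Set.iUnion_subset fun n a ha T hT =>
    D.commute_of_mem_commutant (D.spectralSubspace_subset _ ha) hT

theorem coe_compression_apply {a : H →L[ℂ] H} (ha : a ∈ D.nonnegAlgebra) (x : D.hardySpace) :
    (D.compression a x : H) = a x :=
  congrArg Subtype.val (Submodule.orthogonalProjectionOnto_mem_subspace_eq_self
    (⟨a x, D.nonnegAlgebra_map_hardySpace ha x.2⟩ : D.hardySpace))

theorem compression_mul {a b : H →L[ℂ] H} (ha : a ∈ D.nonnegAlgebra) (hb : b ∈ D.nonnegAlgebra) :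
    D.compression (a * b) = D.compression a * D.compression b := by
  ext x
  change (D.compression (a * b) x : H) = D.compression a (D.compression b x)
  rw [D.coe_compression_apply (mul_mem ha hb), D.coe_compression_apply ha,
    D.coe_compression_apply hb]
  rfl

theorem compression_one : D.compression 1 = 1 := by
  ext x
  rw [D.coe_compression_apply (one_mem _)]
  rfl

theorem compression_add (a b : H →L[ℂ] H) :
    D.compression (a + b) = D.compression a + D.compression b := by
  ext x
  simp [compression]

theorem compression_sub (a b : H →L[ℂ] H) :
    D.compression (a - b) = D.compression a - D.compression b := by
  ext x
  simp [compression]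

theorem compression_smul (c : ℂ) (a : H →L[ℂ] H) :
    D.compression (c • a) = c • D.compression a := by
  ext x
  simp [compression]

theorem continuous_compression : Continuous D.compression := by
  unfold compression
  fun_prop

theorem compression_pow {a : H →L[ℂ] H} (ha : a ∈ D.nonnegAlgebra) (j : ℕ) :
    D.compression (a ^ j) = D.compression a ^ j := by
  induction j with
  | zero => exact D.compression_one
  | succ j ih => rw [pow_succ, D.compression_mul (pow_mem ha j) ha, ih, pow_succ]

theorem star_compression_mul_compression {a : H →L[ℂ] H} (ha : a ∈ D.nonnegAlgebra)
    (haa : star a * a ∈ D.nonnegAlgebra) :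
    star (D.compression a) * D.compression a = D.compression (star a * a) := by
  refine ContinuousLinearMap.ext fun x => ext_inner_left ℂ fun y => ?_
  rw [← inner_map_map, Submodule.coe_inner, Submodule.coe_inner, D.coe_compression_apply ha,
    D.coe_compression_apply ha, D.coe_compression_apply haa, inner_map_map]

theorem pow_mem_spectralSubspace {n : ℤ} {a : H →L[ℂ] H} (ha : a ∈ D.spectralSubspace n) (j : ℕ) :
    a ^ j ∈ D.spectralSubspace (j * n) := by
  induction j with
  | zero => simpa using D.one_mem_spectralSubspace_zero
  | succ j ih =>
    rw [pow_succ, Nat.cast_succ, add_mul, one_mul]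
    exact D.mul_mem_spectralSubspace ih ha

/-- Purity: powers of `a` raise degrees without bound, so `η` has no component in any `H_k`. -/
theorem eq_zero_of_forall_mem_range_pow {n : ℕ} (hn : 0 < n) {a : H →L[ℂ] H}
    (ha : a ∈ D.spectralSubspace n) {η : D.hardySpace}
    (hη : ∀ j : ℕ, ∃ y, (D.compression a ^ j) y = η) : η = 0 := by
  have horth : ∀ k : ℕ, ∀ x ∈ D.hilbertSpectralSubspace k, ⟪(η : H), x⟫_ℂ = 0 := by
    intro k x hx
    -- The power `k + 1` suffices: starting from degree `i ≥ 0` it reaches `(k + 1) n + i > k`.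
    obtain ⟨y, hy⟩ := hη (k + 1)
    have haA := D.mem_nonnegAlgebra ha
    have h1 : (η : H) = (a ^ (k + 1)) y := by
      rw [← hy, ← D.compression_pow haA, D.coe_compression_apply (pow_mem haA _)]
    rw [inner_eq_zero_symm, h1]
    refine D.hardySpace_le
      (K := LinearMap.ker ((innerSL ℂ x ∘L a ^ (k + 1) : H →L[ℂ] ℂ) : H →ₗ[ℂ] ℂ)) ?_ ?_ y.2
    · exact (innerSL ℂ x ∘L a ^ (k + 1)).isClosed_ker
    · intro i w hw
      refine D.inner_eq_zero_of_ne ?_ hx (D.spectralSubspace_map_hilbertSpectralSubspace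
        (D.pow_mem_spectralSubspace ha (k + 1)) hw)
      have h2 : k < (k + 1) * n + i := by nlinarith
      exact_mod_cast h2.ne
  have h1 : ⟪(η : H), (η : H)⟫_ℂ = 0 :=
    D.hardySpace_le (K := LinearMap.ker (innerSL ℂ (η : H) : H →ₗ[ℂ] ℂ))
      (innerSL ℂ (η : H)).isClosed_ker horth η.2
  exact Subtype.ext (inner_self_eq_zero.1 h1)

end NonnegAlgebra

/-! ### Commutation of `algLat M₊` with `M₊` -/

section AlgLat

variable {D} {b : D.hardySpace →L[ℂ] D.hardySpace}

/-- Commutativity of `M` makes the closed range of the compression of `y` invariant under `M₊`. -/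
theorem algLat_map_closure_range (hab : ∀ a ∈ D.M, ∀ b ∈ D.M, a * b = b * a)
    (hb : b ∈ algLat D.analyticAlgebra) {y : H →L[ℂ] H} (hy : y ∈ D.nonnegAlgebra)
    {x : D.hardySpace} (hx : x ∈ closure (Set.range (D.compression y))) :
    b x ∈ closure (Set.range (D.compression y)) := by
  have h := hb (LinearMap.range (D.compression y :
    D.hardySpace →ₗ[ℂ] D.hardySpace)).topologicalClosure ?_ x hx
  · exact h
  refine ⟨Submodule.isClosed_topologicalClosure _, ?_⟩
  rintro _ ⟨a, ha, rfl⟩ z hz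
  refine map_mem_closure (D.compression a).continuous hz ?_
  rintro _ ⟨u, rfl⟩
  refine ⟨D.compression a u, ?_⟩
  change (D.compression y * D.compression a) u = (D.compression a * D.compression y) u
  rw [← D.compression_mul hy ha, ← D.compression_mul ha hy,
    hab _ (D.nonnegAlgebra_subset hy) _ (D.nonnegAlgebra_subset ha)]

theorem algLat_mul_compression_idempotent (hab : ∀ a ∈ D.M, ∀ b ∈ D.M, a * b = b * a)
    (hb : b ∈ algLat D.analyticAlgebra) {e : H →L[ℂ] H} (he : e ∈ D.nonnegAlgebra)
    (hee : e * e = e) : D.compression e * (b * D.compression e) = b * D.compression e := by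
  have hcc : D.compression e * D.compression e = D.compression e := by
    rw [← D.compression_mul he he, hee]
  ext1 x
  refine closure_minimal (t := {x | D.compression e x = x}) ?_
    (isClosed_eq (D.compression e).continuous continuous_id)
    (algLat_map_closure_range hab hb he (subset_closure ⟨x, rfl⟩))
  rintro _ ⟨y, rfl⟩
  exact congr($hcc y)

/-- Both `e` and `1 - e` have ranges invariant under `b`. -/
theorem algLat_commute_compression_idempotent (hab : ∀ a ∈ D.M, ∀ b ∈ D.M, a * b = b * a)
    (hb : b ∈ algLat D.analyticAlgebra) {e : H →L[ℂ] H} (he : e ∈ D.nonnegAlgebra)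
    (hee : e * e = e) : b * D.compression e = D.compression e * b := by
  have h1 := algLat_mul_compression_idempotent hab hb he hee
  have h2 := algLat_mul_compression_idempotent hab hb (sub_mem (one_mem _) he)
    (IsIdempotentElem.one_sub hee)
  rw [compression_sub, compression_one] at h2
  simp only [mul_sub, sub_mul, mul_one, one_mul, h1] at h2
  rw [sub_self, sub_zero, sub_right_inj] at h2
  exact h2.symm

theorem algLat_commute_compression_zero (hab : ∀ a ∈ D.M, ∀ b ∈ D.M, a * b = b * a)
    (hb : b ∈ algLat D.analyticAlgebra) {a : H →L[ℂ] H} (ha : a ∈ D.spectralSubspace 0) :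
    b * D.compression a = D.compression a * b := by
  let W : Submodule ℂ (H →L[ℂ] H) :=
    { carrier := {a | b * D.compression a = D.compression a * b}
      zero_mem' := by
        have : D.compression 0 = 0 := by simpa using D.compression_sub 0 0
        simp [this]
      add_mem' := fun {x y} hx hy => by
        simp only [Set.mem_ofPred_eq] at *
        rw [compression_add, mul_add, add_mul, hx, hy]
      smul_mem' := fun c x hx => by
        simp only [Set.mem_ofPred_eq] at *
        rw [compression_smul]
        exact mul_smul_eq_smul_mul hx c }
  refine mem_of_projections_mem (fun T => D.star_mem_fixedCommutant) W ?_ ?_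
    (D.mem_spectralSubspace_zero_iff.1 ha)
  · exact (isClosed_commutant b).preimage D.continuous_compression
  · intro e he hproj
    exact algLat_commute_compression_idempotent hab hb
      (D.mem_nonnegAlgebra (n := 0) (D.mem_spectralSubspace_zero_iff.2 he)) hproj.isIdempotentElem

theorem algLat_commute_compression_partialIsometry (hab : ∀ a ∈ D.M, ∀ b ∈ D.M, a * b = b * a)
    (hb : b ∈ algLat D.analyticAlgebra) {n : ℕ} (hn : 0 < n) {v : H →L[ℂ] H}
    (hv : v ∈ D.spectralSubspace n) (hvv : v * (star v * v) = v) :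
    b * D.compression v = D.compression v * b := by
  have hvA := D.mem_nonnegAlgebra hv
  have he : star v * v ∈ D.spectralSubspace 0 := by
    simpa using D.mul_mem_spectralSubspace (D.star_mem_spectralSubspace hv) hv
  have heA : star v * v ∈ D.nonnegAlgebra := D.mem_nonnegAlgebra (n := 0) he
  have hev : star v * v * v = v := by
    rw [hab _ (D.nonnegAlgebra_subset heA) _ (D.nonnegAlgebra_subset hvA), hvv]
  refine mul_comm_of_closure_range_invariant (D.star_compression_mul_compression hvA heA)
    ?_ ?_ (algLat_commute_compression_zero hab hb he) ?_
    (fun η => D.eq_zero_of_forall_mem_range_pow hn hv)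
  · rw [← D.compression_mul heA hvA, hev]
  · rw [← D.compression_mul hvA heA, hvv]
  · intro z
    have h1 : (fun y => D.compression v y - z • y) = D.compression (v - z • 1) := by
      ext1 y
      rw [compression_sub, compression_smul, compression_one]
      rfl
    rw [h1]
    exact fun x hx => algLat_map_closure_range hab hb
      (sub_mem hvA (Subalgebra.smul_mem _ (one_mem _) z)) hx

theorem algLat_commute_compression (hab : ∀ a ∈ D.M, ∀ b ∈ D.M, a * b = b * a)
    (hb : b ∈ algLat D.analyticAlgebra) {n : ℕ} {m : H →L[ℂ] H} (hm : m ∈ D.spectralSubspace n) :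
    b * D.compression m = D.compression m * b := by
  rcases Nat.eq_zero_or_pos n with rfl | hn
  · exact algLat_commute_compression_zero hab hb hm
  · obtain ⟨v, hv, h, hh, hvh, -, hvv⟩ := D.exists_polar_mem_spectralSubspace hm
    rw [← hvh, D.compression_mul (D.mem_nonnegAlgebra hv) (D.mem_nonnegAlgebra (n := 0) hh),
      ← mul_assoc, algLat_commute_compression_partialIsometry hab hb hn hv hvv, mul_assoc,
      algLat_commute_compression_zero hab hb hh, mul_assoc]

theorem adjoin_le_nonnegAlgebra :
    Algebra.adjoin ℂ (⋃ n : ℕ, D.spectralSubspace n) ≤ D.nonnegAlgebra :=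
  Algebra.adjoin_le (subset_wotClosedAlgebra _)

theorem algLat_commute_compression_adjoin (hab : ∀ a ∈ D.M, ∀ b ∈ D.M, a * b = b * a)
    (hb : b ∈ algLat D.analyticAlgebra) {x : H →L[ℂ] H}
    (hx : x ∈ Algebra.adjoin ℂ (⋃ n : ℕ, D.spectralSubspace n)) :
    b * D.compression x = D.compression x * b := by
  induction hx using Algebra.adjoin_induction with
  | mem x hx =>
    obtain ⟨n, hn⟩ := Set.mem_iUnion.1 hx
    exact algLat_commute_compression hab hb hn
  | algebraMap c =>
    rw [Algebra.algebraMap_eq_smul_one, compression_smul, compression_one]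
    exact mul_smul_eq_smul_mul (by rw [mul_one, one_mul]) c
  | add x y _ _ hx hy => rw [compression_add, mul_add, add_mul, hx, hy]
  | mul x y hx' hy' hx hy =>
    rw [D.compression_mul (adjoin_le_nonnegAlgebra hx') (adjoin_le_nonnegAlgebra hy'), ← mul_assoc,
      hx, mul_assoc, hy, mul_assoc]

/-! ### Extending `b` to an element of `M` -/

/-- A trigonometric polynomial becomes analytic after multiplication by a suitable isometry. -/
theorem exists_isometry_mul_mem_adjoin (hab : ∀ a ∈ D.M, ∀ b ∈ D.M, a * b = b * a)
    {m : H →L[ℂ] H} (hm : m ∈ D.trigPolynomials) :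
    ∃ w ∈ Algebra.adjoin ℂ (⋃ n : ℕ, D.spectralSubspace n), star w * w = 1 ∧
      w * m ∈ Algebra.adjoin ℂ (⋃ n : ℕ, D.spectralSubspace n) := by
  set A := Algebra.adjoin ℂ (⋃ n : ℕ, D.spectralSubspace n) with hA
  have hmem : ∀ (n : ℕ), ∀ a ∈ D.spectralSubspace n, a ∈ A := fun n a ha =>
    Algebra.subset_adjoin (Set.mem_iUnion.2 ⟨n, ha⟩)
  have hAM : ∀ a ∈ A, a ∈ D.M := fun a ha => D.nonnegAlgebra_subset (adjoin_le_nonnegAlgebra ha)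
  refine D.trigPolynomials_induction (p := fun m => ∃ w ∈ A, star w * w = 1 ∧ w * m ∈ A)
    ?_ ⟨1, one_mem _, by simp, by simp⟩ ?_ ?_ hm
  · intro n m hm
    rcases le_or_gt 0 n with hn | hn
    · lift n to ℕ using hn
      exact ⟨1, one_mem _, by simp, by simpa using hmem n m hm⟩
    · obtain ⟨k, rfl⟩ : ∃ k : ℕ, n = -k := ⟨n.natAbs, by omega⟩
      obtain ⟨v, hv, h, hh, hvh, heh, hve⟩ := D.exists_polar_mem_spectralSubspace hm
      have hvM := D.spectralSubspace_subset _ hv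
      have hsv : star v ∈ D.spectralSubspace k := by
        simpa using D.star_mem_spectralSubspace hv
      have he : star v * v ∈ D.spectralSubspace 0 := by
        simpa using D.mul_mem_spectralSubspace hsv hv
      have hev : star v * v * v = v := by
        rw [hab _ (D.spectralSubspace_subset _ he) _ hvM, hve]
      have hvv : v * star v = star v * v := hab _ hvM _ (star_mem hvM)
      have hse : star (star v * v) = star v * v := by rw [star_mul, star_star]
      have hvse : star v * v * star v = star v := by
        simpa only [star_mul, star_star] using congr(star $hve)
      have hee : star v * v * (star v * v) = star v * v := by rw [← mul_assoc, hvse]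
      -- The adjoint of `v` has degree `k ≥ 0` and undoes the polar part, giving `w m = h` in `M_0`;
      -- the summand `1 - v* v` completes it to an isometry.
      refine ⟨star v + (1 - star v * v), add_mem (hmem k _ hsv)
        (sub_mem (one_mem _) (hmem 0 _ he)), ?_, ?_⟩
      · rw [star_add, star_sub, star_one, hse, star_star]
        simp only [mul_add, add_mul, mul_sub, sub_mul, mul_one, one_mul, hve, hvse, hee, hvv]
        abel
      · have h1 : (star v + (1 - star v * v)) * m = h := by
          rw [← hvh]
          simp only [add_mul, sub_mul, one_mul]
          rw [← mul_assoc, heh, ← mul_assoc (star v * v), hev, sub_self, add_zero]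
        rw [h1]
        exact hmem 0 _ hh
  · rintro a c ⟨w, hw, hww, hwa⟩ ⟨w', hw', hww', hwc⟩
    -- The product serves both summands because `w` and `w'` commute.
    refine ⟨w * w', mul_mem hw hw', ?_, ?_⟩
    · rw [star_mul, mul_assoc, ← mul_assoc (star w), hww, one_mul, hww']
    · rw [mul_add]
      refine add_mem ?_ ?_
      · rw [hab _ (hAM _ hw) _ (hAM _ hw'), mul_assoc]
        exact mul_mem hw' hwa
      · rw [mul_assoc]
        exact mul_mem hw hwc
  · rintro c a ⟨w, hw, hww, hwa⟩
    exact ⟨w, hw, hww, by rw [mul_smul_comm]; exact Subalgebra.smul_mem _ hwa c⟩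

theorem algLat_apply_adjoin (hab : ∀ a ∈ D.M, ∀ b ∈ D.M, a * b = b * a)
    (hb : b ∈ algLat D.analyticAlgebra) {x : H →L[ℂ] H}
    (hx : x ∈ Algebra.adjoin ℂ (⋃ n : ℕ, D.spectralSubspace n)) (ξ : D.hardySpace) :
    x (b ξ : H) = b (D.compression x ξ) := by
  rw [← D.coe_compression_apply (adjoin_le_nonnegAlgebra hx)]
  exact congr(($(algLat_commute_compression_adjoin hab hb hx) ξ : H)).symm

/-- With `w m` analytic, `‖m b ξ₀‖ = ‖w m b ξ₀‖ = ‖b w m ξ₀‖ ≤ ‖b‖ ‖m ξ₀‖`. -/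
theorem norm_apply_algLat_le (hab : ∀ a ∈ D.M, ∀ b ∈ D.M, a * b = b * a)
    (hb : b ∈ algLat D.analyticAlgebra) {m : H →L[ℂ] H} (hm : m ∈ D.trigPolynomials) :
    ‖m (b ⟨D.ξ₀, D.cyclicVector_mem_hardySpace⟩ : H)‖ ≤ ‖b‖ * ‖m D.ξ₀‖ := by
  set ξ : D.hardySpace := ⟨D.ξ₀, D.cyclicVector_mem_hardySpace⟩
  obtain ⟨w, hw, hww, hwm⟩ := exists_isometry_mul_mem_adjoin hab hm
  have hnorm : ∀ y, ‖w y‖ = ‖y‖ := by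
    intro y
    have h1 := inner_map_map w y y
    rw [hww] at h1
    change _ = ⟪y, y⟫_ℂ at h1
    rw [inner_self_eq_norm_sq_to_K, inner_self_eq_norm_sq_to_K] at h1
    have h2 : ‖w y‖ ^ 2 = ‖y‖ ^ 2 := by exact_mod_cast h1
    exact (sq_eq_sq₀ (norm_nonneg _) (norm_nonneg _)).1 h2
  have h1 : ‖m (b ξ : H)‖ = ‖(w * m) (b ξ : H)‖ := (hnorm _).symm
  have h2 : ‖m D.ξ₀‖ = ‖D.compression (w * m) ξ‖ := by
    rw [Submodule.coe_norm, D.coe_compression_apply (adjoin_le_nonnegAlgebra hwm)]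
    exact (hnorm _).symm
  rw [h1, h2, algLat_apply_adjoin hab hb hwm]
  exact b.le_opNorm _

/-- Every element of `algLat M₊` is the compression of an element of `M`. -/
theorem exists_mem_M_of_mem_algLat (hab : ∀ a ∈ D.M, ∀ b ∈ D.M, a * b = b * a)
    (hb : b ∈ algLat D.analyticAlgebra) :
    ∃ a ∈ D.M, ∀ m ∈ D.trigPolynomials,
      a (m D.ξ₀) = m (b ⟨D.ξ₀, D.cyclicVector_mem_hardySpace⟩ : H) := by
  set η : H := (b ⟨D.ξ₀, D.cyclicVector_mem_hardySpace⟩ : H) with hη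
  let e : D.trigPolynomials →ₗ[ℂ] H :=
    (ContinuousLinearMap.apply ℂ H D.ξ₀ : (H →L[ℂ] H) →ₗ[ℂ] H) ∘ₗ D.trigPolynomials.subtype
  let f : D.trigPolynomials →ₗ[ℂ] H :=
    (ContinuousLinearMap.apply ℂ H η : (H →L[ℂ] H) →ₗ[ℂ] H) ∘ₗ D.trigPolynomials.subtype
  have he : DenseRange e := by
    have h := D.dense_trigPolynomials
    rwa [Set.image_eq_range] at h
  set a : H →L[ℂ] H := f.extendOfNorm e with ha_def
  have ha : ∀ m ∈ D.trigPolynomials, a (m D.ξ₀) = m η := fun m hm =>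
    LinearMap.extendOfNorm_eq he ⟨‖b‖, fun x => norm_apply_algLat_le hab hb x.2⟩ ⟨m, hm⟩
  have hmul : ∀ (n : ℤ), ∀ k ∈ D.spectralSubspace n, ∀ m ∈ D.trigPolynomials,
      k * m ∈ D.trigPolynomials := by
    intro n k hk m hm
    refine D.trigPolynomials_induction (p := fun m => k * m ∈ D.trigPolynomials)
      (fun i m hm => D.mem_trigPolynomials (D.mul_mem_spectralSubspace hk hm))
      (by rw [mul_zero]; exact zero_mem _) (fun _ _ h h' => by rw [mul_add]; exact add_mem h h')
      (fun c _ h => by rw [mul_smul_comm]; exact Submodule.smul_mem _ c h) hm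
  have hcent : a ∈ Set.centralizer (D.trigPolynomials : Set (H →L[ℂ] H)) := by
    intro k hk
    refine D.trigPolynomials_induction (p := fun k => k * a = a * k) ?_ (by simp)
      (fun _ _ h h' => by rw [add_mul, mul_add, h, h'])
      (fun c _ h => by rw [smul_mul_assoc, mul_smul_comm, h]) hk
    intro n k hk
    refine ContinuousLinearMap.ext fun x => ?_
    refine congrFun (Continuous.ext_on D.dense_trigPolynomials (k * a).continuous
      (a * k).continuous ?_) x
    rintro _ ⟨m, hm, rfl⟩
    exact (congrArg k (ha m hm)).trans (ha (k * m) (hmul n k hk m hm)).symm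
  refine ⟨a, D.mem_M_of_commute fun T hT => ?_, ha⟩
  -- Both `T` and `a` commute with the trigonometric polynomials, whose commutant is abelian since
  -- `ξ₀` is cyclic for them.
  exact commute_of_mem_centralizer (fun _ => D.star_mem_trigPolynomials)
    (fun x hx y hy => hab _ (D.trigPolynomials_subset hx) _ (D.trigPolynomials_subset hy))
    D.dense_trigPolynomials
    (fun m hm => (D.commute_of_mem_commutant (D.trigPolynomials_subset hm) hT).symm) hcent

theorem algLat_subset (hab : ∀ a ∈ D.M, ∀ b ∈ D.M, a * b = b * a) :
    algLat D.analyticAlgebra ⊆ D.analyticAlgebra := by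
  intro b hb
  set ξ : D.hardySpace := ⟨D.ξ₀, D.cyclicVector_mem_hardySpace⟩ with hξ
  obtain ⟨a, haM, ha⟩ := exists_mem_M_of_mem_algLat hab hb
  have haξ : a D.ξ₀ = b ξ :=
    ha 1 (D.mem_trigPolynomials D.one_mem_spectralSubspace_zero)
  have haA : a ∈ D.nonnegAlgebra :=
    D.mem_nonnegAlgebra_of_apply_mem haM (by rw [haξ]; exact (b ξ).2)
  refine ⟨a, haA, ?_⟩
  -- Extending `b` by zero to `H` makes its agreement with `a` a closed condition, to be checked
  -- only on the vectors `m ξ₀` with `m ∈ M_n`, `n ≥ 0`.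
  have hP : D.hardySpace ≤ LinearMap.ker ((a - D.hardySpace.subtypeL ∘L b ∘L
      D.hardySpace.orthogonalProjectionOnto : H →L[ℂ] H) : H →ₗ[ℂ] H) := by
    refine D.hardySpace_le (ContinuousLinearMap.isClosed_ker _) fun n =>
      (D.hilbertSpectralSubspace_le n).trans
        (Submodule.topologicalClosure_minimal _ ?_ (ContinuousLinearMap.isClosed_ker _))
    rw [Submodule.span_le]
    rintro _ ⟨m, hm, rfl⟩
    have h1 := algLat_apply_adjoin hab hb (Algebra.subset_adjoin (Set.mem_iUnion.2 ⟨n, hm⟩)) ξ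
    change a (m D.ξ₀) - (b (D.compression m ξ) : H) = 0
    rw [ha m (D.mem_trigPolynomials hm), h1, sub_self]
  ext x
  rw [D.coe_compression_apply haA]
  have h1 : a x - (b (D.hardySpace.orthogonalProjectionOnto x) : H) = 0 := hP x.2
  rwa [Submodule.orthogonalProjectionOnto_mem_subspace_eq_self, sub_eq_zero] at h1

end AlgLat

end StandardPeriodicSystem

end

theorem theorem13 {H : Type*} [NormedAddCommGroup H] [InnerProductSpace ℂ H] [CompleteSpace H]
    (D : StandardPeriodicSystem H) (hab : ∀ a ∈ D.M, ∀ b ∈ D.M, a * b = b * a) :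
    IsReflexive D.analyticAlgebra :=
  Set.Subset.antisymm (fun a ha _ hK x hx => hK.2 a ha x hx)
    (StandardPeriodicSystem.algLat_subset hab)
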